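/- Notation. For complex $p_1,\dots,p_5$ with $p_4,p_5\notin\{0,-1,-2,\dots\}$ put $$F(p_1,p_2,p_3;p_4,p_5;x)=\sum_{k\ge 0}\frac{(p_1)_k(p_2)_k(p_3)_k}{(p_4)_k(p_5)_k\,k!}\,x^k\quad(|x|<1),$$ where $(p)_k=p(p+1)\cdots(p+k-1)$. The value $F(p_1,p_2,p_3;p_4,p_5;1)$ is $\lim_{x\to1^-}F(p_1,p_2,p_3;p_4,p_5;x)$ when $\operatorname{Re}(p_4+p_5-p_1-p_2-p_3)>0$, and otherwise, if $p_4+p_5-p_1-p_2-p_3\notin\{0,-1,-2,\dots\}$, it is defined by analytic continuation in the parameters. For $a\in\mathbb C\setminus\mathbb Z$, $f(x)=\frac{2}{2x^2-2x+1}$ and $0<\varepsilon<1/\sqrt2$ put $$\int_{P(0,1)}x^{a}f(x)\,dx=\int_\varepsilon^1x^{a}f(x)\,dx+\frac1{e^{2\pi i a}-1}\int_{C_\varepsilon}x^{a}f(x)\,dx,$$ where $C_\varepsilon$ is the circle $x=\varepsilon e^{2\pi i t}$, $0\le t\le1$, and $x^a=\varepsilon^a e^{2\pi i a t}$ on it;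 for $a=0,1,2,\dots$ let $\int_{P(0,1)}x^af(x)\,dx=\int_0^1x^af(x)\,dx$. Theorem. Let $\alpha\in\mathbb C$ with $2\alpha\notin\mathbb Z$, and let $0<\varepsilon<1/\sqrt2$. (1) If $4\alpha\notin\{1,3,5,\dots\}$, then $$\frac{\alpha}{(\alpha+\frac12)(-2\alpha+\frac12)}\,F\big(1,1,\tfrac12;\alpha+\tfrac32,-2\alpha+\tfrac32;1\big)=\int_{P(0,1)}\frac{2x^{-4\alpha}\,dx}{2x^2-2x+1}-\frac{4^{\alpha}\pi}{\cos(\pi\alpha)}.$$ (2) If $4\alpha\notin\{3,5,7,\dots\}$, then $$\frac{\alpha-\frac12}{(-2\alpha+\frac32)\,\alpha}\,F\big(1,1,\tfrac12;\alpha+1,-2\alpha+\tfrac52;1\big)=\int_{P(0,1)}\frac{2x^{-4\alpha+2}\,dx}{2x^2-2x+1}-\frac{2^{2\alpha-1}\pi}{\cos(\pi\alpha-\frac{\pi}{2})}.$$ -/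

import Mathlib

/-- The hypergeometric series
`₃F₂(p₁,p₂,p₃;p₄,p₅;x) = ∑ₖ (p₁)ₖ (p₂)ₖ (p₃)ₖ / ((p₄)ₖ (p₅)ₖ k!) xᵏ`, for `|x| < 1`. -/
noncomputable def hyp3F2 (p₁ p₂ p₃ p₄ p₅ x : ℂ) : ℂ :=
  ∑' k : ℕ, (ascPochhammer ℂ k).eval p₁ * (ascPochhammer ℂ k).eval p₂ *
    (ascPochhammer ℂ k).eval p₃ /
      ((ascPochhammer ℂ k).eval p₄ * (ascPochhammer ℂ k).eval p₅ * (k.factorial : ℂ)) * x ^ k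

/-- The lower parameters `c = p₅` at which `₃F₂(p₁,p₂,p₃;p₄,c;1)` is regular: neither lower parameter
is a non-positive integer, and neither is `p₄ + c - p₁ - p₂ - p₃`. -/
def hyp3F2Domain (p₁ p₂ p₃ p₄ : ℂ) : Set ℂ :=
  {c | (∀ n : ℕ, p₄ ≠ -(n : ℂ)) ∧ (∀ n : ℕ, c ≠ -(n : ℂ)) ∧
    ∀ n : ℕ, p₄ + c - p₁ - p₂ - p₃ ≠ -(n : ℂ)}

/-- `v` is the value `₃F₂(p₁,p₂,p₃;p₄,p₅;1)`. Where `Re (p₄ + p₅ - p₁ - p₂ - p₃) > 0` this is the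
limit of `₃F₂(p₁,p₂,p₃;p₄,p₅;x)` as `x → 1⁻`. Elsewhere it is given by analytic continuation in the
last parameter; the domain of the continuation is the complement of a countable set, hence connected,
so that `v` is unique. -/
def IsHyp3F2AtOne (p₁ p₂ p₃ p₄ p₅ v : ℂ) : Prop :=
  p₅ ∈ hyp3F2Domain p₁ p₂ p₃ p₄ ∧
  ∃ G : ℂ → ℂ, AnalyticOnNhd ℂ G (hyp3F2Domain p₁ p₂ p₃ p₄) ∧
    (∀ c ∈ hyp3F2Domain p₁ p₂ p₃ p₄, 0 < (p₄ + c - p₁ - p₂ - p₃).re →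
      Filter.Tendsto (fun x : ℝ => hyp3F2 p₁ p₂ p₃ p₄ c (x : ℂ))
        (nhdsWithin (1 : ℝ) (Set.Iio 1)) (nhds (G c))) ∧
    G p₅ = v

theorem IsHyp3F2AtOne.unique {p₁ p₂ p₃ p₄ p₅ v w : ℂ}
    (hv : IsHyp3F2AtOne p₁ p₂ p₃ p₄ p₅ v) (hw : IsHyp3F2AtOne p₁ p₂ p₃ p₄ p₅ w) : v = w := by
  obtain ⟨h5, G, hG, hGl, rfl⟩ := hv
  obtain ⟨-, H, hH, hHl, rfl⟩ := hw
  have hE : hyp3F2Domain p₁ p₂ p₃ p₄ =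
      (Set.range (fun n : ℕ => -(n : ℂ)) ∪
        Set.range (fun n : ℕ => p₁ + p₂ + p₃ - p₄ - (n : ℂ)))ᶜ := by
    ext c
    constructor
    · rintro ⟨-, h1, h2⟩ (⟨n, hn⟩ | ⟨n, hn⟩)
      · exact h1 n hn.symm
      · exact h2 n (by rw [← hn]; ring)
    · intro h
      refine ⟨h5.1, fun n hn => h (Or.inl ⟨n, hn.symm⟩), fun n hn => h (Or.inr ⟨n, ?_⟩)⟩
      linear_combination -hn
  have hconn : IsPreconnected (hyp3F2Domain p₁ p₂ p₃ p₄) := by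
    rw [hE]
    refine (Set.Countable.isConnected_compl_of_one_lt_rank ?_ ?_).isPreconnected
    · rw [Complex.rank_real_complex]; norm_num
    · exact (Set.countable_range _).union (Set.countable_range _)
  have hopen : IsOpen {c : ℂ | 0 < c.re ∧ 0 < (p₄ + c - p₁ - p₂ - p₃).re} :=
    (isOpen_lt continuous_const Complex.continuous_re).inter
      (isOpen_lt continuous_const (Complex.continuous_re.comp (by fun_prop)))
  have hsub : ∀ c : ℂ, 0 < c.re → 0 < (p₄ + c - p₁ - p₂ - p₃).re →
      c ∈ hyp3F2Domain p₁ p₂ p₃ p₄ := by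
    intro c h1 h2
    refine ⟨h5.1, fun n hn => ?_, fun n hn => ?_⟩
    · rw [hn] at h1
      simp only [Complex.neg_re, Complex.natCast_re] at h1
      linarith [n.cast_nonneg (α := ℝ)]
    · rw [hn] at h2
      simp only [Complex.neg_re, Complex.natCast_re] at h2
      linarith [n.cast_nonneg (α := ℝ)]
  set r : ℝ := 1 + |(p₄ - p₁ - p₂ - p₃).re| with hr
  have hr1 : 0 < (r : ℂ).re := by rw [Complex.ofReal_re]; positivity
  have hr2 : 0 < (p₄ + (r : ℂ) - p₁ - p₂ - p₃).re := by
    have := neg_abs_le (p₄ - p₁ - p₂ - p₃).re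
    simp only [Complex.sub_re, Complex.add_re, Complex.ofReal_re] at this hr ⊢
    linarith
  have hev : G =ᶠ[nhds (r : ℂ)] H := by
    filter_upwards [hopen.mem_nhds ⟨hr1, hr2⟩] with c hc
    exact tendsto_nhds_unique (hGl c (hsub c hc.1 hc.2) hc.2) (hHl c (hsub c hc.1 hc.2) hc.2)
  exact hG.eqOn_of_preconnected_of_eventuallyEq hH hconn (hsub _ hr1 hr2) hev h5

open Classical in
/-- The regularized integral `∫_{P(0,1)} xᵃ f(x) dx`, for `f` holomorphic near `[0,1]` and on the
closed disc of radius `ε` around `0`. For `a ∉ ℤ` it is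
`∫_ε^1 xᵃ f(x) dx + (e(a) - 1)⁻¹ ∫_{C_ε} xᵃ f(x) dx`, where `e(t) = exp(2πit)`, `C_ε` is the circle
`t ↦ ε e(t)`, `0 ≤ t ≤ 1`, and `xᵃ = εᵃ e(at)` on `C_ε`. For `a = 0, 1, 2, …` it is the convergent
integral `∫_0^1 xᵃ f(x) dx`. -/
noncomputable def pochhammerIntegral (ε : ℝ) (a : ℂ) (f : ℂ → ℂ) : ℂ :=
  if ∃ n : ℕ, a = n then ∫ x in (0 : ℝ)..1, (x : ℂ) ^ a * f x
  else (∫ x in ε..1, (x : ℂ) ^ a * f x) +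
    1 / (Complex.exp (2 * Real.pi * Complex.I * a) - 1) *
      ∫ t in (0 : ℝ)..1,
        ((ε : ℂ) ^ a * Complex.exp (2 * Real.pi * Complex.I * a * t)) *
          f (ε * Complex.exp (2 * Real.pi * Complex.I * t)) *
          (2 * Real.pi * Complex.I * ε * Complex.exp (2 * Real.pi * Complex.I * t))

/-! Both sides of (1) are analytic in `α` on a domain that is the plane minus a countable set, hence
connected, so it suffices to prove (1) for `α = -δ` with `0 < δ < 1/2`, where series and integral
converge. Assertion (2) is (1) at `α - 1/2`.

For real `δ` put `u = 1/2 - δ`, `v = 1/2 + 2δ`. Up to the factor `-δ` the left side is the sum of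
`k! (1/2)ₖ / ((u)ₖ₊₁ (v)ₖ₊₁)`. Two beta integrals and the binomial series turn it into the integral
of `p^(u-1) q^(v-1) (p + q - pq)^(-1/2)` over the unit square (`tsum_eq_lintegral_lintegral`). After
`p = s²`, `q = sy` the variable `s` survives only in `(1 + s/y - s²)^(-1/2)`, whose `s`-integral is
a sum of arctangents (`integral_inv_sqrt_quadratic`). Integration by parts in `y`
(`integral_arctanKernel`) leaves two integrals: one over `(0,1)`, which `y = x²` turns into the
integral of the theorem, and one over `(0,∞)`, a beta integral giving `4^(-δ) π / cos (πδ)`.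

Two continuations are needed. A telescoping contiguity relation (`hypSum_add_one_right`) expresses
the series through the one with both lower parameters raised by one; iterating it continues the
value at 1 (`analyticAt_hypCont_comp`). Expanding the kernel at 0 and integrating termwise over the
circle shows that the regularized integral is meromorphic in the exponent (`pochhammerIntegral_eq`,
`analyticAt_powerSeriesIntegral`). -/

open Filter Topology Asymptotics MeasureTheory

/-! ### Pochhammer symbols: nonvanishing, bounds, relation to Euler's Gamma sequence. -/

section Pochhammer

theorem ascPochhammer_eval_ne_zero {z : ℂ} (hz : ∀ n : ℕ, z ≠ -(n : ℂ)) (k : ℕ) :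
    (ascPochhammer ℂ k).eval z ≠ 0 := by
  intro h
  obtain ⟨m, -, hm⟩ := (ascPochhammer_eval_eq_zero_iff k z).1 h
  exact hz m (by rw [hm]; ring)

theorem ascPochhammer_eval_eq_prod_range (z : ℂ) (k : ℕ) :
    (ascPochhammer ℂ k).eval z = ∏ j ∈ Finset.range k, (z + j) := by
  induction k with
  | zero => simp
  | succ k ih => rw [ascPochhammer_succ_eval, ih, Finset.prod_range_succ]

/-- `(z + 1)ₖ = (z)ₖ (z + k) / z`, without division. -/
theorem mul_ascPochhammer_eval_add_one (z : ℂ) (k : ℕ) :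
    z * (ascPochhammer ℂ k).eval (z + 1) = (ascPochhammer ℂ k).eval z * (z + k) := by
  induction k with
  | zero => simp
  | succ k ih =>
    rw [ascPochhammer_succ_eval, ← mul_assoc, ih, ascPochhammer_succ_eval]
    push_cast
    ring

/-- The `j`-th factor `z + j` has real part at least `j + 2`. This gives the majorant that makes the
series converge uniformly. -/
theorem factorial_le_norm_ascPochhammer_eval {z : ℂ} (hz : 2 ≤ z.re) (k : ℕ) :
    ((k + 1).factorial : ℝ) ≤ ‖(ascPochhammer ℂ k).eval z‖ := by
  induction k with
  | zero => simp
  | succ k ih =>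
    rw [ascPochhammer_succ_eval, norm_mul, Nat.factorial_succ, Nat.cast_mul, mul_comm]
    have h1 : ((k + 1 + 1 : ℕ) : ℝ) ≤ ‖z + k‖ := by
      refine le_trans ?_ (Complex.re_le_norm _)
      simp only [Complex.add_re, Complex.natCast_re]
      push_cast
      linarith
    gcongr

theorem norm_ascPochhammer_eval_half_le (k : ℕ) :
    ‖(ascPochhammer ℂ k).eval (1 / 2)‖ ≤ (k.factorial : ℝ) := by
  induction k with
  | zero => simp
  | succ k ih =>
    rw [ascPochhammer_succ_eval, norm_mul, Nat.factorial_succ, Nat.cast_mul, mul_comm]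
    have h1 : ‖(1 / 2 : ℂ) + k‖ ≤ ((k + 1 : ℕ) : ℝ) := by
      refine (norm_add_le _ _).trans ?_
      rw [Complex.norm_natCast]
      norm_num
      linarith
    gcongr

theorem half_ne_neg_natCast (n : ℕ) : (1 / 2 : ℂ) ≠ -(n : ℂ) := by
  intro h
  have := congrArg Complex.re h
  simp at this
  linarith [n.cast_nonneg (α := ℝ)]

/-- Euler's limit formula read backwards: since `GammaSeq z n` tends to `Γ(z)`, this yields the
growth of Pochhammer symbols. -/
theorem ascPochhammer_eval_succ_eq_div_GammaSeq {z : ℂ} (hz : ∀ n : ℕ, z ≠ -(n : ℂ))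
    {n : ℕ} (hn : n ≠ 0) :
    (ascPochhammer ℂ (n + 1)).eval z =
      (n : ℂ) ^ z * (n.factorial : ℂ) / Complex.GammaSeq z n := by
  have h0 := ascPochhammer_eval_ne_zero hz (n + 1)
  rw [Complex.GammaSeq, ← ascPochhammer_eval_eq_prod_range, div_div_cancel₀]
  have : (n : ℂ) ^ z ≠ 0 := by
    rw [Complex.cpow_def_of_ne_zero (Nat.cast_ne_zero.2 hn)]
    exact Complex.exp_ne_zero _
  exact mul_ne_zero this (Nat.cast_ne_zero.2 n.factorial_ne_zero)

end Pochhammer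

/-! ### Convergence at 1 and the contiguity relation. -/

/-- The `k`-th term of `₃F₂(1,1,1/2;d,c;1)`. -/
noncomputable def hypTerm (d c : ℂ) (k : ℕ) : ℂ :=
  (k.factorial : ℂ) * (ascPochhammer ℂ k).eval (1 / 2) /
    ((ascPochhammer ℂ k).eval d * (ascPochhammer ℂ k).eval c)

theorem hypTerm_swap (d c : ℂ) : hypTerm d c = hypTerm c d := by
  ext k
  simp only [hypTerm, mul_comm]

theorem hyp3F2_eq_tsum_hypTerm (d c x : ℂ) :
    hyp3F2 1 1 (1 / 2) d c x = ∑' k : ℕ, hypTerm d c k * x ^ k := by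
  refine tsum_congr fun k => ?_
  have : (k.factorial : ℂ) ≠ 0 := Nat.cast_ne_zero.2 k.factorial_ne_zero
  rw [ascPochhammer_eval_one, hypTerm]
  congr 1
  rw [mul_assoc (k.factorial : ℂ), mul_comm _ (k.factorial : ℂ), mul_div_mul_left _ _ this]

theorem hypTerm_succ {d c : ℂ} (hd : ∀ n : ℕ, d ≠ -(n : ℂ)) (hc : ∀ n : ℕ, c ≠ -(n : ℂ)) (k : ℕ) :
    hypTerm d c (k + 1) * ((d + k) * (c + k)) = hypTerm d c k * ((k + 1) * (k + 1 / 2)) := by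
  have h1 := ascPochhammer_eval_ne_zero hd k
  have h2 := ascPochhammer_eval_ne_zero hc k
  have h3 : d + k ≠ 0 := fun h => hd k (by linear_combination h)
  have h4 : c + k ≠ 0 := fun h => hc k (by linear_combination h)
  simp only [hypTerm, ascPochhammer_succ_eval, Nat.factorial_succ]
  push_cast
  field_simp
  ring

theorem hypTerm_add_one_right {d c : ℂ} (hd : ∀ n : ℕ, d ≠ -(n : ℂ)) (hc : ∀ n : ℕ, c ≠ -(n : ℂ))
    (k : ℕ) : hypTerm d (c + 1) k * (c + k) = hypTerm d c k * c := by
  have h1 := ascPochhammer_eval_ne_zero hd k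
  have h2 := ascPochhammer_eval_ne_zero hc k
  have hc0 : c ≠ 0 := by simpa using hc 0
  have h4 : c + k ≠ 0 := fun h => hc k (by linear_combination h)
  have h5 := mul_ascPochhammer_eval_add_one c k
  have h6 : (ascPochhammer ℂ k).eval (c + 1) ≠ 0 := by
    intro h
    rw [h, mul_zero] at h5
    exact mul_ne_zero h2 h4 h5.symm
  simp only [hypTerm]
  field_simp
  linear_combination (-(k.factorial : ℂ) * (ascPochhammer ℂ k).eval (1 / 2)) * h5

/-- With Pochhammer symbols written through Gamma sequences, the factorials cancel up to a factor `n
+ 1`. What remains is `n^(3/2 - d - c)` times a convergent sequence; its limit exists because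
`Γ(1/2) ≠ 0`. -/
theorem hypTerm_isBigO {d c : ℂ} (hd : ∀ n : ℕ, d ≠ -(n : ℂ)) (hc : ∀ n : ℕ, c ≠ -(n : ℂ)) :
    (fun n : ℕ => hypTerm d c (n + 1)) =O[atTop]
      fun n : ℕ => (n : ℝ) ^ (-((d + c - 5 / 2).re + 1)) := by
  have hlim : Tendsto (fun n : ℕ => (1 + 1 / (n : ℂ)) *
      (Complex.GammaSeq d n * Complex.GammaSeq c n / Complex.GammaSeq (1 / 2) n)) atTop
      (𝓝 ((1 + 0) * (Complex.Gamma d * Complex.Gamma c / Complex.Gamma (1 / 2)))) := by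
    refine Tendsto.mul (tendsto_const_nhds.add ?_) ?_
    · simpa using tendsto_inv_atTop_nhds_zero_nat (𝕜 := ℂ)
    · exact ((Complex.GammaSeq_tendsto_Gamma d).mul (Complex.GammaSeq_tendsto_Gamma c)).div
        (Complex.GammaSeq_tendsto_Gamma _) (Complex.Gamma_ne_zero half_ne_neg_natCast)
  have h2 : (fun n : ℕ => (n : ℂ) ^ (-((d + c - 5 / 2) + 1))) =O[atTop]
      fun n : ℕ => (n : ℝ) ^ (-((d + c - 5 / 2).re + 1)) := by
    refine IsBigO.of_bound 1 ?_
    filter_upwards [eventually_gt_atTop 0] with n hn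
    rw [Complex.norm_natCast_cpow_of_pos hn, one_mul]
    simp only [Complex.neg_re, Complex.add_re, Complex.one_re]
    exact le_abs_self _
  have h3 := (hlim.isBigO_one ℝ).mul h2
  simp only [one_mul] at h3
  refine IsBigO.congr' h3 ?_ EventuallyEq.rfl
  filter_upwards [eventually_gt_atTop 0] with n hn
  have hn0 : n ≠ 0 := hn.ne'
  have hnC : (n : ℂ) ≠ 0 := Nat.cast_ne_zero.2 hn0
  have hpow : ∀ z : ℂ, (n : ℂ) ^ z ≠ 0 := fun z => by
    rw [Complex.cpow_def_of_ne_zero hnC]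
    exact Complex.exp_ne_zero _
  have hfac : (n.factorial : ℂ) ≠ 0 := Nat.cast_ne_zero.2 n.factorial_ne_zero
  have hG : ∀ {z : ℂ}, (∀ n : ℕ, z ≠ -(n : ℂ)) → Complex.GammaSeq z n ≠ 0 := by
    intro z hz h
    have h1 := ascPochhammer_eval_succ_eq_div_GammaSeq hz hn0
    rw [h, div_zero] at h1
    exact ascPochhammer_eval_ne_zero hz _ h1
  have hGd := hG hd
  have hGc := hG hc
  have hGh := hG half_ne_neg_natCast
  simp only [hypTerm, ascPochhammer_eval_succ_eq_div_GammaSeq hd hn0,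
    ascPochhammer_eval_succ_eq_div_GammaSeq hc hn0,
    ascPochhammer_eval_succ_eq_div_GammaSeq half_ne_neg_natCast hn0]
  have hexp : (n : ℂ) ^ (-((d + c - 5 / 2) + 1)) =
      (n : ℂ) ^ (1 / 2 : ℂ) * n / ((n : ℂ) ^ d * (n : ℂ) ^ c) := by
    rw [← Complex.cpow_add _ _ hnC, eq_div_iff (hpow _), ← Complex.cpow_add _ _ hnC]
    nth_rewrite 3 [← Complex.cpow_one (n : ℂ)]
    rw [← Complex.cpow_add _ _ hnC]
    congr 1
    ring
  rw [hexp, Nat.factorial_succ]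
  have := hpow d
  have := hpow c
  have := hpow (1 / 2)
  push_cast
  field_simp

/-- The value `₃F₂(1,1,1/2;d,c;1)` as a convergent series. -/
noncomputable def hypSum (d c : ℂ) : ℂ := ∑' k : ℕ, hypTerm d c k

theorem hypSum_swap (d c : ℂ) : hypSum d c = hypSum c d := by
  simp only [hypSum, hypTerm_swap d c]

theorem summable_hypTerm {d c : ℂ} (hd : ∀ n : ℕ, d ≠ -(n : ℂ)) (hc : ∀ n : ℕ, c ≠ -(n : ℂ))
    (hs : 0 < (d + c - 5 / 2).re) : Summable (hypTerm d c) := by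
  rw [← summable_nat_add_iff 1]
  refine summable_of_isBigO_nat ?_ (hypTerm_isBigO hd hc)
  rw [Real.summable_nat_rpow]
  linarith

/-- The boundary term of the telescoping sum behind the contiguity relation. -/
theorem tendsto_mul_hypTerm {d c : ℂ} (hd : ∀ n : ℕ, d ≠ -(n : ℂ)) (hc : ∀ n : ℕ, c ≠ -(n : ℂ))
    (hs : 0 < (d + c - 5 / 2).re) :
    Tendsto (fun k : ℕ => (d - 1 + k) * hypTerm d c k) atTop (𝓝 0) := by
  rw [← tendsto_add_atTop_iff_nat 1]
  have h1 : (fun n : ℕ => (d - 1 + ((n + 1 : ℕ) : ℂ))) =O[atTop] fun n : ℕ => (n : ℝ) := by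
    refine IsBigO.of_bound (‖d‖ + 1) ?_
    filter_upwards [eventually_ge_atTop 1] with n hn
    have hn' : (1 : ℝ) ≤ n := by exact_mod_cast hn
    have : d - 1 + ((n + 1 : ℕ) : ℂ) = d + n := by push_cast; ring
    rw [this]
    refine (norm_add_le _ _).trans ?_
    rw [Complex.norm_natCast, Real.norm_of_nonneg (by positivity)]
    nlinarith [norm_nonneg d]
  refine (h1.mul (hypTerm_isBigO hd hc)).trans_tendsto ?_
  have h2 : Tendsto (fun n : ℕ => (n : ℝ) ^ (-(d + c - 5 / 2).re)) atTop (𝓝 0) :=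
    (tendsto_rpow_neg_atTop hs).comp tendsto_natCast_atTop_atTop
  refine h2.congr' ?_
  filter_upwards [eventually_gt_atTop 0] with n hn
  have hn' : (0 : ℝ) < n := by exact_mod_cast hn
  nth_rewrite 2 [← Real.rpow_one (n : ℝ)]
  rw [← Real.rpow_add hn']
  congr 1
  ring

/-- A contiguity relation. -/
theorem hypSum_add_one_right {d c : ℂ} (hd : ∀ n : ℕ, d ≠ -(n : ℂ)) (hc : ∀ n : ℕ, c ≠ -(n : ℂ))
    (hs : 0 < (d + c - 5 / 2).re) :
    (d + c - 5 / 2) * hypSum d c =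
      (c - 1) * (c - 1 / 2) / c * hypSum d (c + 1) + (d - 1) := by
  have hc0 : c ≠ 0 := by simpa using hc 0
  have hc1 : ∀ n : ℕ, c + 1 ≠ -(n : ℂ) := fun n h => hc (n + 1) (by
    push_cast; linear_combination h)
  have hS := summable_hypTerm hd hc hs
  have hS1 : Summable (hypTerm d (c + 1)) := by
    refine summable_hypTerm hd hc1 ?_
    have : (d + (c + 1) - 5 / 2).re = (d + c - 5 / 2).re + 1 := by
      simp only [Complex.add_re, Complex.sub_re, Complex.one_re]; ring
    linarith
  have hT := tendsto_mul_hypTerm hd hc hs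
  have h1 : HasSum (fun k : ℕ => (d + c - 5 / 2) * hypTerm d c k -
      (c - 1) * (c - 1 / 2) / c * hypTerm d (c + 1) k)
      ((d + c - 5 / 2) * hypSum d c - (c - 1) * (c - 1 / 2) / c * hypSum d (c + 1)) :=
    (hS.hasSum.mul_left _).sub (hS1.hasSum.mul_left _)
  -- With `tₖ = hypTerm d c k`, the summand equals `(d - 1 + k) tₖ - (d + k) tₖ₊₁`, so the sum
  -- telescopes.
  have h2 : ∀ n : ℕ, ∑ k ∈ Finset.range n, ((d + c - 5 / 2) * hypTerm d c k -
      (c - 1) * (c - 1 / 2) / c * hypTerm d (c + 1) k) =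
      (d - 1) - (d - 1 + n) * hypTerm d c n := by
    intro n
    induction n with
    | zero => simp [hypTerm]
    | succ n ih =>
      rw [Finset.sum_range_succ, ih]
      have hcn : c + n ≠ 0 := fun h => hc n (by linear_combination h)
      have hdn : d + n ≠ 0 := fun h => hd n (by linear_combination h)
      have e1 : hypTerm d (c + 1) n = hypTerm d c n * c / (c + n) := by
        rw [eq_div_iff hcn, hypTerm_add_one_right hd hc]
      have e2 : hypTerm d c (n + 1) =
          hypTerm d c n * ((n + 1) * (n + 1 / 2)) / ((d + n) * (c + n)) := by
        rw [eq_div_iff (mul_ne_zero hdn hcn), hypTerm_succ hd hc]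
      rw [e1, e2]
      push_cast
      have : d - 1 + (n + 1 : ℂ) = d + n := by ring
      rw [this]
      field_simp
      ring
  have h3 := h1.tendsto_sum_nat
  simp only [h2] at h3
  have h4 := tendsto_nhds_unique h3 (tendsto_const_nhds.sub hT)
  linear_combination h4

/-! ### Continuation of the value at 1 in both lower parameters. -/

/-- The operator which expresses `₃F₂(1,1,1/2;d,c;1)` in terms of `₃F₂(1,1,1/2;d+1,c+1;1)`. -/
noncomputable def contigStep (f : ℂ → ℂ → ℂ) (d c : ℂ) : ℂ :=
  ((c - 1) * (c - 1 / 2) / c *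
    (((d - 1) * (d - 1 / 2) / d * f (d + 1) (c + 1) + c) / (d + c - 5 / 2 + 1)) + (d - 1)) /
    (d + c - 5 / 2)

/-- The contiguity relation raises `c`; used again with the lower parameters exchanged, it raises
`d`. -/
theorem contigStep_hypSum {d c : ℂ} (hd : ∀ n : ℕ, d ≠ -(n : ℂ)) (hc : ∀ n : ℕ, c ≠ -(n : ℂ))
    (hs : 0 < (d + c - 5 / 2).re) : contigStep hypSum d c = hypSum d c := by
  have hc1 : ∀ n : ℕ, c + 1 ≠ -(n : ℂ) := fun n h => hc (n + 1) (by
    push_cast; linear_combination h)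
  have hs1 : 0 < (d + c - 5 / 2 + 1).re := by
    simp only [Complex.add_re, Complex.one_re] at hs ⊢
    linarith
  have h0 : d + c - 5 / 2 ≠ 0 := fun h => by simp [h] at hs
  have h1 : d + c - 5 / 2 + 1 ≠ 0 := fun h => by simp [h] at hs1
  have e1 := hypSum_add_one_right hd hc hs
  have e2 := hypSum_add_one_right hc1 hd (by
    rwa [show c + 1 + d - 5 / 2 = d + c - 5 / 2 + 1 by ring])
  rw [hypSum_swap (c + 1) d, hypSum_swap (c + 1) (d + 1)] at e2
  rw [contigStep, div_eq_iff h0, mul_comm (hypSum d c), e1]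
  congr 2
  rw [div_eq_iff h1]
  linear_combination -e2

/-- Iterated application of the contiguity relations. -/
noncomputable def hypIter : ℕ → ℂ → ℂ → ℂ
  | 0 => hypSum
  | n + 1 => contigStep (hypIter n)

theorem add_one_ne_neg_natCast {z : ℂ} (hz : ∀ n : ℕ, z ≠ -(n : ℂ)) (n : ℕ) :
    z + 1 ≠ -(n : ℂ) := fun h => hz (n + 1) (by push_cast; linear_combination h)

theorem ne_neg_natCast_of_re_pos {z : ℂ} (hz : 0 < z.re) (n : ℕ) : z ≠ -(n : ℂ) := by
  rintro rfl
  simp only [Complex.neg_re, Complex.natCast_re] at hz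
  linarith [n.cast_nonneg (α := ℝ)]

theorem hypIter_eq_hypSum (N : ℕ) {d c : ℂ} (hd : ∀ n : ℕ, d ≠ -(n : ℂ))
    (hc : ∀ n : ℕ, c ≠ -(n : ℂ)) (hs : 0 < (d + c - 5 / 2).re) :
    hypIter N d c = hypSum d c := by
  induction N generalizing d c with
  | zero => rfl
  | succ N ih =>
    have hs2 : 0 < (d + 1 + (c + 1) - 5 / 2).re := by
      simp only [Complex.add_re, Complex.sub_re, Complex.one_re] at hs ⊢
      linarith
    rw [← contigStep_hypSum hd hc hs, hypIter, contigStep, contigStep,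
      ih (add_one_ne_neg_natCast hd) (add_one_ne_neg_natCast hc) hs2]

/-- After `N` shifts both parameters lie in the region of convergence, where one more step changes
nothing. The outer steps are the same on both sides, so their denominators need not be nonzero. -/
theorem hypIter_succ (N : ℕ) {d c : ℂ} (hd : 2 < d.re + N) (hc : 2 < c.re + N) :
    hypIter (N + 1) d c = hypIter N d c := by
  induction N generalizing d c with
  | zero =>
    simp only [Nat.cast_zero, add_zero] at hd hc
    refine contigStep_hypSum (ne_neg_natCast_of_re_pos (by linarith))
      (ne_neg_natCast_of_re_pos (by linarith)) ?_
    simp only [Complex.add_re, Complex.sub_re]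
    norm_num
    linarith
  | succ N ih =>
    push_cast at hd hc
    rw [hypIter, contigStep, ih (d := d + 1) (c := c + 1)
      (by simp only [Complex.add_re, Complex.one_re]; linarith)
      (by simp only [Complex.add_re, Complex.one_re]; linarith), hypIter, contigStep]

theorem hypIter_eq_of_le {N M : ℕ} (hNM : N ≤ M) {d c : ℂ} (hd : 2 < d.re + N)
    (hc : 2 < c.re + N) : hypIter M d c = hypIter N d c := by
  induction M, hNM using Nat.le_induction with
  | base => rfl
  | succ M hM ih =>
    have : (N : ℝ) ≤ M := by exact_mod_cast hM
    rw [hypIter_succ M (by linarith) (by linarith), ih]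

/-- The Weierstrass majorant, independent of the parameters. -/
theorem norm_hypTerm_le {d c : ℂ} (hd : 2 ≤ d.re) (hc : 2 ≤ c.re) (k : ℕ) :
    ‖hypTerm d c k‖ ≤ 1 / ((k + 1 : ℕ) : ℝ) ^ 2 := by
  rw [hypTerm, norm_div, norm_mul, norm_mul, Complex.norm_natCast]
  have h1 := factorial_le_norm_ascPochhammer_eval hd k
  have h2 := factorial_le_norm_ascPochhammer_eval hc k
  have h3 := norm_ascPochhammer_eval_half_le k
  have h4 : (0 : ℝ) < (k.factorial : ℝ) := by exact_mod_cast k.factorial_pos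
  have h5 : (0 : ℝ) < ((k + 1).factorial : ℝ) := by exact_mod_cast (k + 1).factorial_pos
  calc _ ≤ (k.factorial : ℝ) * (k.factorial : ℝ) /
        (((k + 1).factorial : ℝ) * ((k + 1).factorial : ℝ)) := by gcongr
    _ = _ := by
      rw [Nat.factorial_succ]
      push_cast
      field_simp

theorem analyticAt_hypSum_comp {d c : ℂ → ℂ} (hd : Differentiable ℂ d) (hc : Differentiable ℂ c)
    {w : ℂ} (hdw : 2 < (d w).re) (hcw : 2 < (c w).re) :
    AnalyticAt ℂ (fun z => hypSum (d z) (c z)) w := by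
  have hU : IsOpen {z | 2 < (d z).re ∧ 2 < (c z).re} :=
    (isOpen_lt continuous_const (Complex.continuous_re.comp hd.continuous)).inter
      (isOpen_lt continuous_const (Complex.continuous_re.comp hc.continuous))
  have hsum : Summable fun k : ℕ => 1 / ((k + 1 : ℕ) : ℝ) ^ 2 :=
    (summable_nat_add_iff 1).2 (Real.summable_one_div_nat_pow.2 one_lt_two)
  have hD : DifferentiableOn ℂ (fun z => ∑' k : ℕ, hypTerm (d z) (c z) k)
      {z | 2 < (d z).re ∧ 2 < (c z).re} := by
    refine Complex.differentiableOn_tsum_of_summable_norm hsum (fun k => ?_) hU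
      fun k z hz => norm_hypTerm_le hz.1.le hz.2.le k
    intro z hz
    have h1 := ascPochhammer_eval_ne_zero
      (ne_neg_natCast_of_re_pos (z := d z) (by linarith [hz.1])) k
    have h2 := ascPochhammer_eval_ne_zero
      (ne_neg_natCast_of_re_pos (z := c z) (by linarith [hz.2])) k
    have hp := (ascPochhammer ℂ k).differentiable
    exact ((differentiableAt_const _).div
      (((hp _).comp z (hd z)).mul ((hp _).comp z (hc z)))
      (mul_ne_zero h1 h2)).differentiableWithinAt
  exact hD.analyticAt (hU.mem_nhds ⟨hdw, hcw⟩)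

/-- Each step divides by `d`, `c`, `d + c - 5/2` and `d + c - 3/2`, and the nonvanishing hypotheses
survive the shift. Letting `d` and `c` be entire functions of one variable covers both continuation
in `c` alone and continuation along the line traced by `α`. -/
theorem analyticAt_hypIter_comp (N : ℕ) {d c : ℂ → ℂ} (hd : Differentiable ℂ d)
    (hc : Differentiable ℂ c) {w : ℂ} (hdw : 2 < (d w).re + N) (hcw : 2 < (c w).re + N)
    (hd' : ∀ n : ℕ, d w ≠ -(n : ℂ)) (hc' : ∀ n : ℕ, c w ≠ -(n : ℂ))
    (hs : ∀ n : ℕ, d w + c w - 5 / 2 ≠ -(n : ℂ)) :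
    AnalyticAt ℂ (fun z => hypIter N (d z) (c z)) w := by
  induction N generalizing d c with
  | zero => exact analyticAt_hypSum_comp hd hc (by simpa using hdw) (by simpa using hcw)
  | succ N ih =>
    push_cast at hdw hcw
    have h := ih (hd.add_const 1) (hc.add_const 1)
      (by simp only [Complex.add_re, Complex.one_re]; linarith)
      (by simp only [Complex.add_re, Complex.one_re]; linarith)
      (add_one_ne_neg_natCast hd') (add_one_ne_neg_natCast hc')
      (fun n hn => hs (n + 2) (by push_cast; linear_combination hn))
    have hda : AnalyticAt ℂ d w := hd.analyticAt w
    have hca : AnalyticAt ℂ c w := hc.analyticAt w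
    have hd0 : d w ≠ 0 := by simpa using hd' 0
    have hc0 : c w ≠ 0 := by simpa using hc' 0
    have hs0 : d w + c w - 5 / 2 ≠ 0 := by simpa using hs 0
    have hs1 : d w + c w - 5 / 2 + 1 ≠ 0 := fun h => hs 1 (by push_cast; linear_combination h)
    simp only [hypIter, contigStep]
    refine AnalyticAt.div (AnalyticAt.add (AnalyticAt.mul (AnalyticAt.div ?_ hca hc0)
      (AnalyticAt.div (AnalyticAt.add (AnalyticAt.mul (AnalyticAt.div ?_ hda hd0) h) hca)
        ?_ hs1)) ?_) ?_ hs0 <;> fun_prop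

/-- The analytic continuation of `₃F₂(1,1,1/2;d,c;1)` in `d` and `c`. -/
noncomputable def hypCont (d c : ℂ) : ℂ := hypIter (⌈3 - d.re⌉₊ + ⌈3 - c.re⌉₊) d c

/-- The number of steps in `hypCont` jumps with `d` and `c`; here it is replaced by any sufficient
one, which can be held fixed near a point. -/
theorem hypCont_eq_hypIter {N : ℕ} {d c : ℂ} (hd : 2 < d.re + N) (hc : 2 < c.re + N) :
    hypCont d c = hypIter N d c := by
  have h1 : 3 - d.re ≤ (⌈3 - d.re⌉₊ : ℝ) := Nat.le_ceil _
  have h2 : 3 - c.re ≤ (⌈3 - c.re⌉₊ : ℝ) := Nat.le_ceil _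
  have h3 : (0 : ℝ) ≤ (⌈3 - d.re⌉₊ : ℝ) := Nat.cast_nonneg _
  have h4 : (0 : ℝ) ≤ (⌈3 - c.re⌉₊ : ℝ) := Nat.cast_nonneg _
  rw [hypCont]
  rcases le_total N (⌈3 - d.re⌉₊ + ⌈3 - c.re⌉₊) with h | h
  · exact hypIter_eq_of_le h hd hc
  · refine (hypIter_eq_of_le h ?_ ?_).symm <;> push_cast <;> linarith

theorem hypCont_eq_hypSum {d c : ℂ} (hd : ∀ n : ℕ, d ≠ -(n : ℂ))
    (hc : ∀ n : ℕ, c ≠ -(n : ℂ)) (hs : 0 < (d + c - 5 / 2).re) :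
    hypCont d c = hypSum d c := hypIter_eq_hypSum _ hd hc hs

theorem analyticAt_hypCont_comp {d c : ℂ → ℂ} (hd : Differentiable ℂ d)
    (hc : Differentiable ℂ c) {w : ℂ} (hd' : ∀ n : ℕ, d w ≠ -(n : ℂ))
    (hc' : ∀ n : ℕ, c w ≠ -(n : ℂ)) (hs : ∀ n : ℕ, d w + c w - 5 / 2 ≠ -(n : ℂ)) :
    AnalyticAt ℂ (fun z => hypCont (d z) (c z)) w := by
  obtain ⟨N, hN⟩ := exists_nat_gt (max (2 - (d w).re) (2 - (c w).re))
  have h1 : 2 < (d w).re + N := by linarith [(le_max_left _ _).trans_lt hN]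
  have h2 : 2 < (c w).re + N := by linarith [(le_max_right _ _).trans_lt hN]
  refine (analyticAt_hypIter_comp N hd hc h1 h2 hd' hc' hs).congr ?_
  have hU : IsOpen {z | 2 < (d z).re + N ∧ 2 < (c z).re + N} :=
    (isOpen_lt continuous_const ((Complex.continuous_re.comp hd.continuous).add_const _)).inter
      (isOpen_lt continuous_const ((Complex.continuous_re.comp hc.continuous).add_const _))
  filter_upwards [hU.mem_nhds ⟨h1, h2⟩] with z hz
  exact (hypCont_eq_hypIter hz.1 hz.2).symm

theorem isHyp3F2AtOne_hypCont {d c : ℂ} (hd : ∀ n : ℕ, d ≠ -(n : ℂ))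
    (hc : ∀ n : ℕ, c ≠ -(n : ℂ)) (hs : ∀ n : ℕ, d + c - 5 / 2 ≠ -(n : ℂ)) :
    IsHyp3F2AtOne 1 1 (1 / 2) d c (hypCont d c) := by
  have hsub : ∀ z : ℂ, d + z - 1 - 1 - 1 / 2 = d + z - 5 / 2 := fun z => by ring
  refine ⟨⟨hd, hc, fun n => by rw [hsub]; exact hs n⟩, hypCont d, fun z hz => ?_,
    fun z hz hz' => ?_, rfl⟩
  · exact analyticAt_hypCont_comp (differentiable_const d) differentiable_id hz.1 hz.2.1
      fun n => by rw [← hsub]; exact hz.2.2 n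
  · rw [hsub] at hz'
    rw [hypCont_eq_hypSum hz.1 hz.2.1 hz']
    -- Abel's limit theorem identifies the limit at `1⁻` with the sum of the series at 1.
    have h := Complex.tendsto_tsum_powerSeries_nhdsWithin_lt
      (summable_hypTerm hz.1 hz.2.1 hz').hasSum.tendsto_sum_nat
    rw [tendsto_map'_iff] at h
    refine h.congr fun x => ?_
    rw [hyp3F2_eq_tsum_hypTerm]
    rfl

/-! ### The regularized integral as a function of the exponent. -/

section PochhammerIntegral

variable {f : ℂ → ℂ} {c : ℕ → ℂ} {ε : ℝ}

/-- The integral over `(0, ε)` of `xᵃ ∑ cₙ xⁿ`, continued in `a`. -/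
noncomputable def powerSeriesIntegral (c : ℕ → ℂ) (ε : ℝ) (a : ℂ) : ℂ :=
  ∑' n : ℕ, c n * ((ε : ℂ) ^ (a + n + 1) / (a + n + 1))

theorem ofReal_cpow_add_natCast_add_one (hε : 0 < ε) (a : ℂ) (n : ℕ) :
    (ε : ℂ) ^ (a + n + 1) = (ε : ℂ) ^ a * ε ^ n * ε := by
  have h : (ε : ℂ) ≠ 0 := by exact_mod_cast hε.ne'
  rw [Complex.cpow_add _ _ h, Complex.cpow_add _ _ h, Complex.cpow_natCast, Complex.cpow_one]

/-- For `Re a ≥ 0` the factor `xᵃ` is bounded by `ε^(Re a)` on `(0, ε]`, so constants dominate the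
terms and the series may be integrated termwise. -/
theorem hasSum_integral_cpow_mul (hε : 0 < ε) (hc : Summable fun n => ‖c n‖ * ε ^ n)
    (hf : ∀ x : ℂ, ‖x‖ ≤ ε → HasSum (fun n => c n * x ^ n) (f x)) {a : ℂ} (ha : 0 ≤ a.re) :
    HasSum (fun n : ℕ => c n * ((ε : ℂ) ^ (a + n + 1) / (a + n + 1)))
      (∫ x in (0 : ℝ)..ε, (x : ℂ) ^ a * f x) := by
  have key : HasSum (fun n : ℕ => ∫ x in (0 : ℝ)..ε, (x : ℂ) ^ a * (c n * (x : ℂ) ^ n))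
      (∫ x in (0 : ℝ)..ε, (x : ℂ) ^ a * f x) := by
    refine intervalIntegral.hasSum_integral_of_dominated_convergence
      (fun n _ => ε ^ a.re * (‖c n‖ * ε ^ n)) (fun n => ?_) (fun n => ?_) ?_ ?_ ?_
    · exact Measurable.aestronglyMeasurable (by fun_prop)
    · refine ae_of_all _ fun x hx => ?_
      rw [Set.uIoc_of_le hε.le] at hx
      rw [norm_mul, norm_mul, norm_pow, Complex.norm_cpow_eq_rpow_re_of_pos hx.1,
        Complex.norm_real, Real.norm_of_nonneg hx.1.le]
      have := hx.1.le
      have := hx.2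
      gcongr
    · exact ae_of_all _ fun x _ => hc.mul_left _
    · exact intervalIntegrable_const
    · refine ae_of_all _ fun x hx => ?_
      rw [Set.uIoc_of_le hε.le] at hx
      refine (hf x ?_).mul_left _
      rw [Complex.norm_real, Real.norm_of_nonneg hx.1.le]
      exact hx.2
  convert key using 2 with n
  have h1 : ∀ x ∈ Set.uIcc 0 ε, x ≠ 0 → (x : ℂ) ^ a * (c n * (x : ℂ) ^ n) =
      c n * (x : ℂ) ^ (a + n) := by
    intro x _ hx
    rw [Complex.cpow_add _ _ (by exact_mod_cast hx), Complex.cpow_natCast]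
    ring
  have h2 : ∫ x in (0 : ℝ)..ε, (x : ℂ) ^ a * (c n * (x : ℂ) ^ n) =
      ∫ x in (0 : ℝ)..ε, c n * (x : ℂ) ^ (a + n) := by
    refine intervalIntegral.integral_congr_ae (ae_of_all _ fun x hx => ?_)
    rw [Set.uIoc_of_le hε.le] at hx
    exact h1 x (by rw [Set.uIcc_of_le hε.le]; exact ⟨hx.1.le, hx.2⟩) hx.1.ne'
  have h3 : 0 < (a + n + 1).re := by
    simp only [Complex.add_re, Complex.natCast_re, Complex.one_re]
    positivity
  rw [h2, intervalIntegral.integral_const_mul, integral_cpow (Or.inl ?_)]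
  · rw [Complex.ofReal_zero, Complex.zero_cpow, sub_zero]
    intro h
    simp [h] at h3
  · simp only [Complex.add_re, Complex.natCast_re, Complex.one_re] at h3 ⊢
    linarith

theorem integral_zero_one_cpow_mul (hε : 0 < ε) (hε1 : ε ≤ 1)
    (hc : Summable fun n => ‖c n‖ * ε ^ n)
    (hf : ∀ x : ℂ, ‖x‖ ≤ ε → HasSum (fun n => c n * x ^ n) (f x))
    (hcont : ContinuousOn (fun x : ℝ => f x) (Set.Icc 0 1)) {a : ℂ} (ha : 0 ≤ a.re) :
    ∫ x in (0 : ℝ)..1, (x : ℂ) ^ a * f x =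
      (∫ x in ε..1, (x : ℂ) ^ a * f x) + powerSeriesIntegral c ε a := by
  have h : IntervalIntegrable (fun x : ℝ => (x : ℂ) ^ a * f x) volume 0 1 := by
    refine IntervalIntegrable.mul_continuousOn
      (intervalIntegral.intervalIntegrable_cpow' (by linarith)) ?_
    rwa [Set.uIcc_of_le zero_le_one]
  rw [powerSeriesIntegral, (hasSum_integral_cpow_mul hε hc hf ha).tsum_eq, add_comm,
    intervalIntegral.integral_add_adjacent_intervals]
  · refine h.mono_set ?_
    rw [Set.uIcc_of_le hε.le, Set.uIcc_of_le zero_le_one]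
    exact Set.Icc_subset_Icc_right hε1
  · refine h.mono_set ?_
    rw [Set.uIcc_of_le hε1, Set.uIcc_of_le zero_le_one]
    exact Set.Icc_subset_Icc_left hε.le

/-- Each power integrates to an exponential over one period, and `e(a + n + 1) = e(a)`. Every term
thus carries the factor `e(a) - 1`, which the regularization divides out. -/
theorem hasSum_integral_circle (hε : 0 < ε) (hc : Summable fun n => ‖c n‖ * ε ^ n)
    (hf : ∀ x : ℂ, ‖x‖ ≤ ε → HasSum (fun n => c n * x ^ n) (f x)) {a : ℂ}
    (ha : ∀ n : ℕ, a + n + 1 ≠ 0) :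
    HasSum (fun n : ℕ => (Complex.exp (2 * Real.pi * Complex.I * a) - 1) *
        (c n * ((ε : ℂ) ^ (a + n + 1) / (a + n + 1))))
      (∫ t in (0 : ℝ)..1,
        ((ε : ℂ) ^ a * Complex.exp (2 * Real.pi * Complex.I * a * t)) *
          f (ε * Complex.exp (2 * Real.pi * Complex.I * t)) *
          (2 * Real.pi * Complex.I * ε * Complex.exp (2 * Real.pi * Complex.I * t))) := by
  set E : ℝ → ℂ := fun t => Complex.exp (2 * Real.pi * Complex.I * t) with hE
  have hEn : ∀ t, ‖E t‖ = 1 := fun t => by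
    simp only [hE]
    rw [show (2 * Real.pi * Complex.I * t : ℂ) = ((2 * Real.pi * t : ℝ) : ℂ) * Complex.I by
      push_cast; ring]
    exact Complex.norm_exp_ofReal_mul_I _
  have hpi : (2 * Real.pi * Complex.I : ℂ) ≠ 0 := Complex.two_pi_I_ne_zero
  set g : ℝ → ℂ := fun t => ((ε : ℂ) ^ a * Complex.exp (2 * Real.pi * Complex.I * a * t)) *
    (2 * Real.pi * Complex.I * ε * E t) with hg
  have hgc : Continuous g := by
    simp only [hg, hE]
    fun_prop
  have key : HasSum (fun n : ℕ => ∫ t in (0 : ℝ)..1, g t * (c n * (ε * E t) ^ n))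
      (∫ t in (0 : ℝ)..1, g t * f (ε * E t)) := by
    refine intervalIntegral.hasSum_integral_of_dominated_convergence
      (fun n t => ‖g t‖ * (‖c n‖ * ε ^ n)) (fun n => ?_) (fun n => ?_) ?_ ?_ ?_
    · refine Continuous.aestronglyMeasurable ?_
      simp only [hE]
      fun_prop
    · refine ae_of_all _ fun t _ => ?_
      have e : ‖c n * (ε * E t) ^ n‖ = ‖c n‖ * ε ^ n := by
        rw [norm_mul, norm_pow, norm_mul, hEn, Complex.norm_real, Real.norm_of_nonneg hε.le,
          mul_one]
      exact ((norm_mul _ _).trans (congrArg _ e)).le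
    · exact ae_of_all _ fun t _ => hc.mul_left _
    · simp only [tsum_mul_left]
      exact (hgc.norm.mul continuous_const).intervalIntegrable _ _
    · refine ae_of_all _ fun t _ => (hf _ ?_).mul_left _
      rw [norm_mul, hEn, Complex.norm_real, Real.norm_of_nonneg hε.le, mul_one]
  convert key using 1
  · ext n
    have hne : 2 * Real.pi * Complex.I * (a + n + 1) ≠ 0 := mul_ne_zero hpi (ha n)
    have h1 : ∀ t : ℝ, g t * (c n * (ε * E t) ^ n) =
        (c n * ((ε : ℂ) ^ a * ε ^ n * ε) * (2 * Real.pi * Complex.I)) *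
          Complex.exp (2 * Real.pi * Complex.I * (a + n + 1) * t) := by
      intro t
      have : Complex.exp (2 * Real.pi * Complex.I * (a + n + 1) * t) =
          Complex.exp (2 * Real.pi * Complex.I * a * t) * E t ^ n * E t := by
        simp only [hE]
        rw [← Complex.exp_nat_mul, ← Complex.exp_add, ← Complex.exp_add]
        congr 1
        ring
      rw [this, hg, mul_pow]
      ring
    simp only [h1]
    rw [intervalIntegral.integral_const_mul, integral_exp_mul_complex hne,
      ofReal_cpow_add_natCast_add_one hε]
    have h2 : Complex.exp (2 * Real.pi * Complex.I * (a + n + 1) * (1 : ℝ)) =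
        Complex.exp (2 * Real.pi * Complex.I * a) := by
      rw [show 2 * Real.pi * Complex.I * (a + n + 1) * (1 : ℝ) =
        2 * Real.pi * Complex.I * a + ((n + 1 : ℕ) : ℂ) * (2 * Real.pi * Complex.I) by
          push_cast; ring, Complex.exp_add, Complex.exp_nat_mul_two_pi_mul_I, mul_one]
    rw [h2, Complex.ofReal_zero, mul_zero, Complex.exp_zero]
    have := ha n
    field_simp
  · refine intervalIntegral.integral_congr fun t _ => ?_
    simp only [hg, hE]
    ring

/-- The regularized integral as a meromorphic function of the exponent. -/
theorem pochhammerIntegral_eq (hε : 0 < ε) (hε1 : ε ≤ 1)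
    (hc : Summable fun n => ‖c n‖ * ε ^ n)
    (hf : ∀ x : ℂ, ‖x‖ ≤ ε → HasSum (fun n => c n * x ^ n) (f x))
    (hcont : ContinuousOn (fun x : ℝ => f x) (Set.Icc 0 1)) {a : ℂ}
    (ha : ∀ n : ℕ, a + n + 1 ≠ 0) :
    pochhammerIntegral ε a f =
      (∫ x in ε..1, (x : ℂ) ^ a * f x) + powerSeriesIntegral c ε a := by
  rw [pochhammerIntegral]
  split_ifs with h
  · obtain ⟨n, rfl⟩ := h
    exact integral_zero_one_cpow_mul hε hε1 hc hf hcont (by simp)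
  · have hne : Complex.exp (2 * Real.pi * Complex.I * a) - 1 ≠ 0 := by
      intro h0
      obtain ⟨m, hm⟩ := Complex.exp_eq_one_iff.1 (sub_eq_zero.1 h0)
      have hm' : a = m := by
        have := Complex.two_pi_I_ne_zero
        apply mul_left_cancel₀ this
        rw [hm]
        ring
      rcases m with n | n
      · exact h ⟨n, by simpa using hm'⟩
      · refine ha n ?_
        rw [hm', Int.cast_negSucc]
        push_cast
        ring
    rw [← (hasSum_integral_circle hε hc hf ha).tsum_eq, tsum_mul_left, one_div,
      inv_mul_cancel_left₀ hne, powerSeriesIntegral]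

theorem analyticAt_powerSeriesIntegral (hε : 0 < ε) (hc : Summable fun n => ‖c n‖ * ε ^ n) {a : ℂ}
    (ha : ∀ n : ℕ, a + n + 1 ≠ 0) : AnalyticAt ℂ (powerSeriesIntegral c ε) a := by
  have hcl : IsClosed (Set.range fun n : ℕ => -((n : ℂ) + 1)) := by
    have h1 : IsClosed (Set.range ((↑) : ℕ → ℂ)) :=
      (Complex.isometry_ofReal.isClosedEmbedding.comp Nat.isClosedEmbedding_coe_real).isClosed_range
    have h2 : (Set.range fun n : ℕ => -((n : ℂ) + 1)) =
        (fun z : ℂ => -z - 1) ⁻¹' Set.range ((↑) : ℕ → ℂ) := by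
      ext z
      constructor
      · rintro ⟨n, rfl⟩
        exact ⟨n, by ring⟩
      · rintro ⟨n, hn⟩
        exact ⟨n, by simp only [hn]; ring⟩
    rw [h2]
    exact h1.preimage (by fun_prop)
  have hmem : a ∈ (Set.range fun n : ℕ => -((n : ℂ) + 1))ᶜ := by
    rintro ⟨n, hn⟩
    exact ha n (by rw [← hn]; ring)
  -- The poles `-1, -2, …` form a closed set; on half of a ball avoiding them, `|z + n + 1|` is
  -- bounded below uniformly in `n`.
  obtain ⟨r, hr, hball⟩ := Metric.isOpen_iff.1 hcl.isOpen_compl a hmem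
  have hlow : ∀ z ∈ Metric.ball a (r / 2), ∀ n : ℕ, r / 2 ≤ ‖z + n + 1‖ := by
    intro z hz n
    by_contra! hlt
    have : -((n : ℂ) + 1) ∈ Metric.ball a r := by
      rw [Metric.mem_ball, dist_eq_norm]
      rw [Metric.mem_ball, dist_eq_norm] at hz
      calc ‖-((n : ℂ) + 1) - a‖ = ‖(z - a) - (z + n + 1)‖ := by congr 1; ring
        _ ≤ ‖z - a‖ + ‖z + n + 1‖ := norm_sub_le _ _
        _ < r := by linarith
    exact hball this ⟨n, rfl⟩
  have hεC : (ε : ℂ) ≠ 0 := by exact_mod_cast hε.ne'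
  have hD : DifferentiableOn ℂ
      (fun z => ∑' n : ℕ, c n * ((ε : ℂ) ^ n * ε / (z + n + 1))) (Metric.ball a (r / 2)) := by
    refine Complex.differentiableOn_tsum_of_summable_norm (u := fun n => ‖c n‖ * ε ^ n *
      (ε / (r / 2))) (hc.mul_right _) (fun n => ?_) Metric.isOpen_ball fun n z hz => ?_
    · intro z hz
      have : z + n + 1 ≠ 0 := by
        rw [← norm_pos_iff]
        linarith [hlow z hz n]
      refine DifferentiableAt.differentiableWithinAt ?_
      fun_prop (disch := assumption)
    · have h1 := hlow z hz n
      rw [norm_mul, norm_div, norm_mul, norm_pow, Complex.norm_real, Real.norm_of_nonneg hε.le,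
        mul_div_assoc, mul_assoc]
      gcongr
  have h2 : powerSeriesIntegral c ε =
      fun z => (ε : ℂ) ^ z * ∑' n : ℕ, c n * ((ε : ℂ) ^ n * ε / (z + n + 1)) := by
    ext z
    rw [powerSeriesIntegral, ← tsum_mul_left]
    refine tsum_congr fun n => ?_
    rw [ofReal_cpow_add_natCast_add_one hε]
    ring
  rw [h2]
  refine AnalyticAt.mul ?_ (hD.analyticAt (Metric.isOpen_ball.mem_nhds
    (Metric.mem_ball_self (by linarith))))
  refine Differentiable.analyticAt (fun z => ?_) _
  exact (hasDerivAt_id z).const_cpow (Or.inl hεC) |>.differentiableAt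

/-- The integral is the Mellin transform at `a + 1` of a function supported in `[ε, 1]`; vanishing
near 0 and near infinity, it imposes no restriction on the strip. -/
theorem differentiable_integral_cpow_mul (hε : 0 < ε) (hε1 : ε ≤ 1)
    (hcont : ContinuousOn (fun x : ℝ => f x) (Set.Icc 0 1)) :
    Differentiable ℂ fun a : ℂ => ∫ x in ε..1, (x : ℂ) ^ a * f x := by
  set h : ℝ → ℂ := (Set.Ioc ε 1).indicator fun x : ℝ => f x with hh
  have hint : Integrable h := by
    refine IntegrableOn.integrable_indicator ?_ measurableSet_Ioc
    exact (hcont.mono (Set.Icc_subset_Icc_left hε.le)).integrableOn_Icc.mono_set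
      Set.Ioc_subset_Icc_self
  have heq : (fun a : ℂ => ∫ x in ε..1, (x : ℂ) ^ a * f x) = fun a => mellin h (a + 1) := by
    ext a
    rw [mellin, intervalIntegral.integral_of_le hε1, ← integral_indicator measurableSet_Ioc,
      ← integral_indicator measurableSet_Ioi]
    congr 1
    ext x
    by_cases hx : x ∈ Set.Ioc ε 1
    · have hx0 : x ∈ Set.Ioi 0 := lt_trans hε hx.1
      simp only [hh, Set.indicator_of_mem hx, Set.indicator_of_mem hx0, add_sub_cancel_right,
        smul_eq_mul]
    · by_cases hx0 : x ∈ Set.Ioi (0 : ℝ)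
      · simp [hh, Set.indicator_of_notMem hx, Set.indicator_of_mem hx0]
      · simp [Set.indicator_of_notMem hx, Set.indicator_of_notMem hx0]
  rw [heq]
  intro a
  have hbot : h =ᶠ[𝓝[>] 0] 0 := by
    refine mem_nhdsWithin_of_mem_nhds ?_
    filter_upwards [gt_mem_nhds hε] with x hx
    exact Set.indicator_of_notMem (fun h' => absurd h'.1 hx.not_gt) _
  have htop : h =ᶠ[atTop] 0 := by
    filter_upwards [eventually_gt_atTop 1] with x hx
    exact Set.indicator_of_notMem (fun h' => absurd h'.2 hx.not_ge) _
  have hm := mellin_differentiableAt_of_isBigO_rpow (s := a + 1) (a := (a + 1).re + 1)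
    (b := (a + 1).re - 1) (hint.locallyIntegrable.locallyIntegrableOn _)
    (htop.trans_isBigO (isBigO_zero _ _)) (by linarith)
    (hbot.trans_isBigO (isBigO_zero _ _)) (by linarith)
  exact (differentiableAt_comp_add_const (f := mellin h)).2 hm

end PochhammerIntegral

/-! ### The kernel `2 / (2x² - 2x + 1)`. -/

section Kernel

/-- The Taylor coefficients of `2 / (2x² - 2x + 1)` at `0`. -/
noncomputable def kernelCoeff (n : ℕ) : ℂ :=
  -Complex.I * ((1 + Complex.I) ^ (n + 1) - (1 - Complex.I) ^ (n + 1))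

theorem norm_one_add_I : ‖1 + Complex.I‖ = √2 := by
  rw [Complex.norm_def, Complex.normSq_apply]
  norm_num

theorem norm_one_sub_I : ‖1 - Complex.I‖ = √2 := by
  rw [Complex.norm_def, Complex.normSq_apply]
  norm_num

/-- Partial fractions: the denominator is `(1 - (1+i)x)(1 - (1-i)x)`, with roots of modulus `1/√2`,
whence the bound on `ε`. -/
theorem hasSum_kernelCoeff {x : ℂ} (hx : ‖x‖ < 1 / √2) :
    HasSum (fun n => kernelCoeff n * x ^ n) (2 / (2 * x ^ 2 - 2 * x + 1)) := by
  have h2 : (0 : ℝ) < √2 := by positivity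
  have hlt : √2 * ‖x‖ < 1 := by
    rw [lt_div_iff₀ h2] at hx
    linarith
  have h1 : ‖(1 + Complex.I) * x‖ < 1 := by rwa [norm_mul, norm_one_add_I]
  have h1' : ‖(1 - Complex.I) * x‖ < 1 := by rwa [norm_mul, norm_one_sub_I]
  have hne : 1 - (1 + Complex.I) * x ≠ 0 := fun h => by
    rw [← sub_eq_zero.1 h] at h1
    simp at h1
  have hne' : 1 - (1 - Complex.I) * x ≠ 0 := fun h => by
    rw [← sub_eq_zero.1 h] at h1'
    simp at h1'
  have hs := (((hasSum_geometric_of_norm_lt_one h1).mul_left (1 + Complex.I)).sub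
    ((hasSum_geometric_of_norm_lt_one h1').mul_left (1 - Complex.I))).mul_left (-Complex.I)
  convert! hs using 1
  · ext n
    rw [kernelCoeff, mul_pow, mul_pow, pow_succ, pow_succ]
    ring
  · have hden : 2 * x ^ 2 - 2 * x + 1 =
        (1 - (1 + Complex.I) * x) * (1 - (1 - Complex.I) * x) := by
      linear_combination x ^ 2 * Complex.I_sq
    rw [hden]
    obtain ⟨u, hu⟩ : ∃ u, u = 1 - (1 + Complex.I) * x := ⟨_, rfl⟩
    obtain ⟨v, hv⟩ : ∃ v, v = 1 - (1 - Complex.I) * x := ⟨_, rfl⟩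
    rw [← hu] at hne ⊢
    rw [← hv] at hne' ⊢
    field_simp
    rw [hu, hv]
    linear_combination 2 * Complex.I_sq

theorem summable_norm_kernelCoeff {ε : ℝ} (hε : 0 < ε) (hε' : ε < 1 / √2) :
    Summable fun n => ‖kernelCoeff n‖ * ε ^ n := by
  have h2 : (0 : ℝ) < √2 := by positivity
  have hlt : √2 * ε < 1 := by
    rw [lt_div_iff₀ h2] at hε'
    linarith
  refine Summable.of_nonneg_of_le (fun n => by positivity) (fun n => ?_)
    ((summable_geometric_of_lt_one (by positivity) hlt).mul_left (2 * √2))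
  have : ‖kernelCoeff n‖ ≤ √2 ^ (n + 1) + √2 ^ (n + 1) := by
    rw [kernelCoeff, norm_mul, norm_neg, Complex.norm_I, one_mul]
    refine (norm_sub_le _ _).trans ?_
    rw [norm_pow, norm_pow, norm_one_add_I, norm_one_sub_I]
  calc ‖kernelCoeff n‖ * ε ^ n ≤ (√2 ^ (n + 1) + √2 ^ (n + 1)) * ε ^ n := by gcongr
    _ = 2 * √2 * (√2 * ε) ^ n := by rw [mul_pow, pow_succ]; ring

theorem kernel_denom_pos (x : ℝ) : 0 < 2 * x ^ 2 - 2 * x + 1 := by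
  nlinarith [sq_nonneg (2 * x - 1)]

theorem continuous_kernel : Continuous fun x : ℝ => (2 : ℂ) / (2 * (x : ℂ) ^ 2 - 2 * x + 1) := by
  refine Continuous.div (by fun_prop) (by fun_prop) fun x => ?_
  exact_mod_cast (kernel_denom_pos x).ne'

/-- The regularized integral of `xᵃ · 2 / (2x² - 2x + 1)`, as an analytic function of `a`. -/
noncomputable def kernelIntegral (ε : ℝ) (a : ℂ) : ℂ :=
  (∫ x in ε..1, (x : ℂ) ^ a * (2 / (2 * (x : ℂ) ^ 2 - 2 * x + 1))) +
    powerSeriesIntegral kernelCoeff ε a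

variable {ε : ℝ} {a : ℂ}

theorem lt_one_of_lt_one_div_sqrt_two (hε' : ε < 1 / √2) : ε < 1 := by
  refine hε'.trans_le ?_
  rw [div_le_one (by positivity)]
  exact Real.one_le_sqrt.2 one_le_two

theorem pochhammerIntegral_kernel (hε : 0 < ε) (hε' : ε < 1 / √2)
    (ha : ∀ n : ℕ, a + n + 1 ≠ 0) :
    pochhammerIntegral ε a (fun x => 2 / (2 * x ^ 2 - 2 * x + 1)) = kernelIntegral ε a :=
  pochhammerIntegral_eq hε (lt_one_of_lt_one_div_sqrt_two hε').le
    (summable_norm_kernelCoeff hε hε') (fun _ hx => hasSum_kernelCoeff (hx.trans_lt hε'))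
    continuous_kernel.continuousOn ha

theorem integral_zero_one_kernel (hε : 0 < ε) (hε' : ε < 1 / √2) (ha : 0 ≤ a.re) :
    ∫ x in (0 : ℝ)..1, (x : ℂ) ^ a * (2 / (2 * (x : ℂ) ^ 2 - 2 * x + 1)) = kernelIntegral ε a :=
  integral_zero_one_cpow_mul (f := fun x => 2 / (2 * x ^ 2 - 2 * x + 1)) hε
    (lt_one_of_lt_one_div_sqrt_two hε').le
    (summable_norm_kernelCoeff hε hε') (fun _ hx => hasSum_kernelCoeff (hx.trans_lt hε'))
    continuous_kernel.continuousOn ha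

theorem analyticAt_kernelIntegral (hε : 0 < ε) (hε' : ε < 1 / √2)
    (ha : ∀ n : ℕ, a + n + 1 ≠ 0) : AnalyticAt ℂ (kernelIntegral ε) a :=
  AnalyticAt.add ((differentiable_integral_cpow_mul (f := fun x => 2 / (2 * x ^ 2 - 2 * x + 1)) hε
    (lt_one_of_lt_one_div_sqrt_two hε').le continuous_kernel.continuousOn).analyticAt a)
    (analyticAt_powerSeriesIntegral hε (summable_norm_kernelCoeff hε hε') ha)

end Kernel

/-! ### The series as a double integral. -/

section DoubleIntegral

theorem ascPochhammer_eval_pos {u : ℝ} (hu : 0 < u) (n : ℕ) : 0 < (ascPochhammer ℝ n).eval u :=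
  ascPochhammer_pos n u hu

theorem ofReal_ascPochhammer_eval (u : ℝ) (n : ℕ) :
    (((ascPochhammer ℝ n).eval u : ℝ) : ℂ) = (ascPochhammer ℂ n).eval (u : ℂ) := by
  induction n with
  | zero => simp
  | succ n ih => rw [ascPochhammer_succ_eval, ascPochhammer_succ_eval, ← ih]; push_cast; rfl

/-- Euler's `B(u, n + 1)`. Working in `ENNReal` lets the later interchanges go through with no
integrability to check. -/
theorem lintegral_rpow_mul_one_sub_pow {u : ℝ} (hu : 0 < u) (n : ℕ) :
    ∫⁻ x in Set.Ioo (0 : ℝ) 1, ENNReal.ofReal (x ^ (u - 1) * (1 - x) ^ n) =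
      ENNReal.ofReal (n.factorial / (ascPochhammer ℝ (n + 1)).eval u) := by
  have hint : IntervalIntegrable (fun x : ℝ => x ^ (u - 1) * (1 - x) ^ n) volume 0 1 :=
    (intervalIntegral.intervalIntegrable_rpow' (by linarith)).mul_continuousOn (by fun_prop)
  have hval : ∫ x in (0 : ℝ)..1, x ^ (u - 1) * (1 - x) ^ n =
      n.factorial / (ascPochhammer ℝ (n + 1)).eval u := by
    have h := Complex.betaIntegral_eval_nat_add_one_right (u := (u : ℂ)) (by simpa using hu) n
    rw [← ascPochhammer_eval_eq_prod_range, ← ofReal_ascPochhammer_eval, Complex.betaIntegral] at h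
    have h2 : ∫ x in (0 : ℝ)..1, (x : ℂ) ^ ((u : ℂ) - 1) * (1 - (x : ℂ)) ^ ((n : ℂ) + 1 - 1) =
        ∫ x in (0 : ℝ)..1, ((x ^ (u - 1) * (1 - x) ^ n : ℝ) : ℂ) := by
      refine intervalIntegral.integral_congr fun x hx => ?_
      rw [Set.uIcc_of_le zero_le_one] at hx
      simp only [add_sub_cancel_right, Complex.cpow_natCast]
      push_cast
      rw [Complex.ofReal_cpow hx.1]
      push_cast
      rfl
    rw [h2, intervalIntegral.integral_ofReal] at h
    exact_mod_cast h
  rw [← hval, intervalIntegral.integral_of_le zero_le_one, integral_Ioc_eq_integral_Ioo,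
    ofReal_integral_eq_lintegral_ofReal]
  · exact (intervalIntegrable_iff_integrableOn_Ioo_of_le zero_le_one).1 hint
  · refine (ae_restrict_iff' measurableSet_Ioo).2 (ae_of_all _ fun x hx => ?_)
    have h1 := hx.1.le
    have h2 : 0 ≤ 1 - x := by linarith [hx.2]
    positivity

theorem hasSum_ascPochhammer_half {w : ℝ} (h0 : 0 ≤ w) (h1 : w < 1) :
    HasSum (fun n : ℕ => (ascPochhammer ℝ n).eval (1 / 2) / n.factorial * w ^ n) (√(1 - w))⁻¹ := by
  have h := (Real.one_div_one_sub_rpow_hasFPowerSeriesOnBall_zero (1 / 2)).hasSum (y := w) (by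
    rw [← ENNReal.ofReal_one, Metric.eball_ofReal]
    simpa [abs_of_nonneg h0] using h1)
  simp only [zero_add, one_div] at h
  rw [show √(1 - w) = (1 - w) ^ (2⁻¹ : ℝ) by rw [Real.sqrt_eq_rpow, one_div]]
  convert! h using 1
  ext n
  have h2 := Ring.factorial_nsmul_multichoose_eq_ascPochhammer (1 / 2 : ℝ) n
  rw [Polynomial.ascPochhammer_smeval_eq_eval, nsmul_eq_mul] at h2
  have h3 : Ring.choose ((2 : ℝ)⁻¹ + n - 1) n = Ring.multichoose (1 / 2 : ℝ) n := by
    rw [Ring.choose]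
    congr 1
    ring
  have h4 : (n.factorial : ℝ) ≠ 0 := by exact_mod_cast n.factorial_ne_zero
  simp only [FormalMultilinearSeries.ofScalars_apply_eq, smul_eq_mul]
  rw [h3, ← h2, mul_div_cancel_left₀ _ h4]

/-- Each term is `(1/2)ₖ / k!` times two beta integrals; under the integral sign the binomial series
is summed at `w = (1-p)(1-q)`, where `1 - w = p + q - pq`. -/
theorem tsum_eq_lintegral_lintegral {u v : ℝ} (hu : 0 < u) (hv : 0 < v) :
    ∑' k : ℕ, ENNReal.ofReal (k.factorial * (ascPochhammer ℝ k).eval (1 / 2) /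
        ((ascPochhammer ℝ (k + 1)).eval u * (ascPochhammer ℝ (k + 1)).eval v)) =
      ∫⁻ p in Set.Ioo (0 : ℝ) 1, ∫⁻ q in Set.Ioo (0 : ℝ) 1,
        ENNReal.ofReal (p ^ (u - 1) * (q ^ (v - 1) * (√(p + q - p * q))⁻¹)) := by
  have hterm : ∀ k : ℕ, ENNReal.ofReal (k.factorial * (ascPochhammer ℝ k).eval (1 / 2) /
      ((ascPochhammer ℝ (k + 1)).eval u * (ascPochhammer ℝ (k + 1)).eval v)) =
      ∫⁻ p in Set.Ioo (0 : ℝ) 1, ∫⁻ q in Set.Ioo (0 : ℝ) 1,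
        ENNReal.ofReal (p ^ (u - 1) * (1 - p) ^ k) *
          (ENNReal.ofReal ((ascPochhammer ℝ k).eval (1 / 2) / k.factorial) *
            ENNReal.ofReal (q ^ (v - 1) * (1 - q) ^ k)) := by
    intro k
    have h1 := ascPochhammer_eval_pos hu (k + 1)
    have h2 := ascPochhammer_eval_pos hv (k + 1)
    have h3 := ascPochhammer_eval_pos (u := 1 / 2) (by norm_num) k
    have h4 : (0 : ℝ) < k.factorial := by exact_mod_cast k.factorial_pos
    have h5 : ∀ p : ℝ, ∫⁻ q in Set.Ioo (0 : ℝ) 1,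
        ENNReal.ofReal (p ^ (u - 1) * (1 - p) ^ k) *
          (ENNReal.ofReal ((ascPochhammer ℝ k).eval (1 / 2) / k.factorial) *
            ENNReal.ofReal (q ^ (v - 1) * (1 - q) ^ k)) =
        ENNReal.ofReal (p ^ (u - 1) * (1 - p) ^ k) *
          (ENNReal.ofReal ((ascPochhammer ℝ k).eval (1 / 2) / k.factorial) *
            ENNReal.ofReal (k.factorial / (ascPochhammer ℝ (k + 1)).eval v)) := by
      intro p
      rw [lintegral_const_mul _ (by fun_prop), lintegral_const_mul _ (by fun_prop),
        lintegral_rpow_mul_one_sub_pow hv]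
    simp only [h5]
    rw [lintegral_mul_const _ (by fun_prop), lintegral_rpow_mul_one_sub_pow hu,
      ← ENNReal.ofReal_mul (by positivity), ← ENNReal.ofReal_mul (by positivity)]
    congr 1
    field_simp
  simp only [hterm]
  rw [← lintegral_tsum fun k => by
    refine Measurable.aemeasurable (Measurable.lintegral_prod_right' (f := fun z : ℝ × ℝ =>
      ENNReal.ofReal (z.1 ^ (u - 1) * (1 - z.1) ^ k) *
          (ENNReal.ofReal ((ascPochhammer ℝ k).eval (1 / 2) / k.factorial) *
            ENNReal.ofReal (z.2 ^ (v - 1) * (1 - z.2) ^ k))) ?_)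
    fun_prop]
  refine setLIntegral_congr_fun measurableSet_Ioo fun p hp => ?_
  rw [← lintegral_tsum fun k => by fun_prop]
  refine setLIntegral_congr_fun measurableSet_Ioo fun q hq => ?_
  have hp1 : 0 < 1 - p := by linarith [hp.2]
  have hq1 : 0 < 1 - q := by linarith [hq.2]
  have hp0 := hp.1
  have hq0 := hq.1
  have hw : (1 - p) * (1 - q) < 1 := by nlinarith
  have hs := hasSum_ascPochhammer_half (mul_pos hp1 hq1).le hw
  rw [show p + q - p * q = 1 - (1 - p) * (1 - q) by ring, ← mul_assoc, mul_comm, ← hs.tsum_eq,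
    ENNReal.ofReal_mul' (by positivity), ENNReal.ofReal_tsum_of_nonneg _ hs.summable,
    ← ENNReal.tsum_mul_right]
  · refine tsum_congr fun k => ?_
    have h3 := ascPochhammer_eval_pos (u := 1 / 2) (by norm_num) k
    rw [← ENNReal.ofReal_mul (by positivity), ← ENNReal.ofReal_mul (by positivity),
      ← ENNReal.ofReal_mul (by positivity)]
    congr 1
    rw [mul_pow]
    ring
  · intro k
    have h3 := ascPochhammer_eval_pos (u := 1 / 2) (by norm_num) k
    positivity

theorem image_sq_Ioo : (fun s : ℝ => s ^ 2) '' Set.Ioo 0 1 = Set.Ioo 0 1 := by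
  ext p
  constructor
  · rintro ⟨s, hs, rfl⟩
    exact ⟨pow_pos hs.1 2, pow_lt_one₀ hs.1.le hs.2 two_ne_zero⟩
  · intro hp
    refine ⟨√p, ⟨Real.sqrt_pos.2 hp.1, ?_⟩, Real.sq_sqrt hp.1.le⟩
    rw [Real.sqrt_lt' one_pos]
    simpa using hp.2

theorem injOn_sq_Ioo : Set.InjOn (fun s : ℝ => s ^ 2) (Set.Ioo 0 1) := by
  intro s hs t ht h
  exact (pow_left_inj₀ hs.1.le ht.1.le two_ne_zero).1 h

/-- Substitute `p = s²`, then `q = sy` for fixed `s`. For these two exponents all powers of `s`,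
including `s²` from the Jacobians, cancel. -/
theorem lintegral_lintegral_substitution {δ : ℝ} :
    ∫⁻ p in Set.Ioo (0 : ℝ) 1, ∫⁻ q in Set.Ioo (0 : ℝ) 1,
        ENNReal.ofReal (p ^ ((1 / 2 - δ) - 1) * (q ^ ((1 / 2 + 2 * δ) - 1) *
          (√(p + q - p * q))⁻¹)) =
      ∫⁻ s in Set.Ioo (0 : ℝ) 1, ∫⁻ y in Set.Ioo (0 : ℝ) (1 / s),
        ENNReal.ofReal (2 * y ^ (2 * δ - 1) * (√(1 + s / y - s ^ 2))⁻¹) := by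
  conv_lhs => rw [← image_sq_Ioo]
  rw [lintegral_image_eq_lintegral_abs_deriv_mul (f' := fun s => 2 * s) measurableSet_Ioo
    (fun s _ => by simpa using (hasDerivAt_pow 2 s).hasDerivWithinAt) injOn_sq_Ioo]
  rw [image_sq_Ioo]
  refine setLIntegral_congr_fun measurableSet_Ioo fun s hs => ?_
  have hs0 := hs.1
  have himg : (fun y : ℝ => s * y) '' Set.Ioo 0 (1 / s) = Set.Ioo 0 1 := by
    rw [Set.image_mul_left_Ioo hs0, mul_zero, mul_one_div_cancel hs0.ne']
  rw [← himg, lintegral_image_eq_lintegral_abs_deriv_mul (f' := fun _ => s) measurableSet_Ioo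
    (fun y _ => by simpa using ((hasDerivAt_id y).const_mul s).hasDerivWithinAt)
    (fun y _ z _ h => mul_left_cancel₀ hs0.ne' h),
    ← lintegral_const_mul' _ _ ENNReal.ofReal_ne_top]
  refine setLIntegral_congr_fun measurableSet_Ioo fun y hy => ?_
  have hy0 := hy.1
  rw [abs_of_pos hs0, abs_of_pos (by positivity), ← ENNReal.ofReal_mul (by positivity),
    ← ENNReal.ofReal_mul (by positivity)]
  congr 1
  have e1 : s ^ 2 + s * y - s ^ 2 * (s * y) = (s * y) * (1 + s / y - s ^ 2) := by
    field_simp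
    ring
  have e2 : (s ^ 2 : ℝ) ^ ((1 / 2 - δ) - 1) = s ^ (2 * ((1 / 2 - δ) - 1)) := by
    rw [← Real.rpow_natCast, ← Real.rpow_mul hs0.le]
    norm_num
  have e3 : s ^ (2 * ((1 / 2 - δ) - 1)) * s ^ ((1 / 2 + 2 * δ) - 1) * s ^ (-(1 / 2) : ℝ) * s ^ 2
      = 1 := by
    rw [← Real.rpow_natCast, ← Real.rpow_add hs0, ← Real.rpow_add hs0, ← Real.rpow_add hs0]
    convert Real.rpow_zero s using 2
    push_cast
    ring
  have e4 : y ^ ((1 / 2 + 2 * δ) - 1) * y ^ (-(1 / 2) : ℝ) = y ^ (2 * δ - 1) := by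
    rw [← Real.rpow_add hy0]
    congr 1
    ring
  rw [e1, e2, Real.sqrt_mul (by positivity), mul_inv, Real.mul_rpow hs0.le hy0.le,
    Real.sqrt_eq_rpow (s * y), ← Real.rpow_neg (by positivity), Real.mul_rpow hs0.le hy0.le]
  calc _ = 2 * (s ^ (2 * ((1 / 2 - δ) - 1)) * s ^ ((1 / 2 + 2 * δ) - 1) * s ^ (-(1 / 2) : ℝ) *
        s ^ 2) * (y ^ ((1 / 2 + 2 * δ) - 1) * y ^ (-(1 / 2) : ℝ)) *
        (√(1 + s / y - s ^ 2))⁻¹ := by ring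
    _ = _ := by rw [e3, e4, mul_one]

theorem lintegral_lintegral_swap_hyperbola {g : ℝ → ℝ → ENNReal}
    (hg : Measurable fun z : ℝ × ℝ => g z.1 z.2) :
    ∫⁻ s in Set.Ioo (0 : ℝ) 1, ∫⁻ y in Set.Ioo (0 : ℝ) (1 / s), g s y =
      ∫⁻ y in Set.Ioi (0 : ℝ), ∫⁻ s in Set.Ioo (0 : ℝ) (min 1 (1 / y)), g s y := by
  set R : Set (ℝ × ℝ) := {z | 0 < z.1 ∧ z.1 < 1 ∧ 0 < z.2 ∧ z.1 * z.2 < 1} with hR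
  have hRm : MeasurableSet R := by
    refine (measurableSet_lt measurable_const measurable_fst).inter
      ((measurableSet_lt measurable_fst measurable_const).inter
      ((measurableSet_lt measurable_const measurable_snd).inter
      (measurableSet_lt (measurable_fst.mul measurable_snd) measurable_const)))
  have h1 : ∫⁻ s in Set.Ioo (0 : ℝ) 1, ∫⁻ y in Set.Ioo (0 : ℝ) (1 / s), g s y =
      ∫⁻ s, ∫⁻ y, R.indicator (fun z => g z.1 z.2) (s, y) := by
    rw [← lintegral_indicator measurableSet_Ioo]
    refine lintegral_congr fun s => ?_
    by_cases hs : s ∈ Set.Ioo (0 : ℝ) 1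
    · rw [Set.indicator_of_mem hs, ← lintegral_indicator measurableSet_Ioo]
      refine lintegral_congr fun y => ?_
      have : y ∈ Set.Ioo (0 : ℝ) (1 / s) ↔ (s, y) ∈ R := by
        simp only [hR, Set.mem_Ioo, Set.mem_ofPred_eq, lt_div_iff₀ hs.1, mul_comm y s]
        exact ⟨fun h => ⟨hs.1, hs.2, h.1, h.2⟩, fun h => h.2.2⟩
      by_cases hy : (s, y) ∈ R
      · rw [Set.indicator_of_mem hy, Set.indicator_of_mem (this.2 hy)]
      · rw [Set.indicator_of_notMem hy, Set.indicator_of_notMem (fun h => hy (this.1 h))]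
    · rw [Set.indicator_of_notMem hs, eq_comm]
      have : ∀ y, R.indicator (fun z => g z.1 z.2) (s, y) = 0 := fun y =>
        Set.indicator_of_notMem (fun h => hs ⟨h.1, h.2.1⟩) _
      simp [this]
  have h2 : ∫⁻ y in Set.Ioi (0 : ℝ), ∫⁻ s in Set.Ioo (0 : ℝ) (min 1 (1 / y)), g s y =
      ∫⁻ y, ∫⁻ s, R.indicator (fun z => g z.1 z.2) (s, y) := by
    rw [← lintegral_indicator measurableSet_Ioi]
    refine lintegral_congr fun y => ?_
    by_cases hy : y ∈ Set.Ioi (0 : ℝ)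
    · rw [Set.indicator_of_mem hy, ← lintegral_indicator measurableSet_Ioo]
      refine lintegral_congr fun s => ?_
      have : s ∈ Set.Ioo (0 : ℝ) (min 1 (1 / y)) ↔ (s, y) ∈ R := by
        simp only [hR, Set.mem_Ioo, Set.mem_ofPred_eq, lt_min_iff, lt_div_iff₀ (Set.mem_Ioi.1 hy)]
        exact ⟨fun h => ⟨h.1, h.2.1, hy, h.2.2⟩, fun h => ⟨h.1, h.2.1, h.2.2.2⟩⟩
      by_cases hs : (s, y) ∈ R
      · rw [Set.indicator_of_mem hs, Set.indicator_of_mem (this.2 hs)]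
      · rw [Set.indicator_of_notMem hs, Set.indicator_of_notMem (fun h => hs (this.1 h))]
    · rw [Set.indicator_of_notMem hy, eq_comm]
      have : ∀ s, R.indicator (fun z => g z.1 z.2) (s, y) = 0 := fun s =>
        Set.indicator_of_notMem (fun h => hy h.2.2.1) _
      simp [this]
  rw [h1, h2, lintegral_lintegral_swap]
  exact (hg.indicator hRm).aemeasurable

end DoubleIntegral

/-! ### The inner integral and its derivative. -/

section ArctanKernel

/-- `∫₀¹ (1 + s/y - s²)^(-1/2) ds` for `0 < y ≤ 1`. -/
noncomputable def arctanNear (y : ℝ) : ℝ :=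
  Real.arctan (√y - 1 / (2 * √y)) + Real.arctan (1 / (2 * y))

/-- `∫₀^(1/y) (1 + s/y - s²)^(-1/2) ds` for `1 ≤ y`. -/
noncomputable def arctanFar (y : ℝ) : ℝ := 2 * Real.arctan (1 / (2 * y))

open Classical in
/-- `∫ (1 + s/y - s²)^(-1/2) ds` over `0 < s < min 1 (1/y)`. -/
noncomputable def arctanKernel (y : ℝ) : ℝ := if y ≤ 1 then arctanNear y else arctanFar y

theorem measurable_arctanKernel : Measurable arctanKernel := by
  refine Measurable.ite measurableSet_Iic ?_ ?_
  · unfold arctanNear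
    fun_prop
  · unfold arctanFar
    fun_prop

variable {y : ℝ}

theorem quadratic_pos (hy : 0 < y) {s : ℝ} (hs0 : 0 ≤ s) (hs1 : s ≤ 1) :
    0 < 1 + s / y - s ^ 2 := by
  rcases hs0.eq_or_lt with rfl | h
  · simp
  · have : 0 < s / y := by positivity
    nlinarith

/-- Completing the square gives the primitive `arctan ((s - 1/(2y)) / √(1 + s/y - s²))`. For `y > 1`
the interval is symmetric about `1/(2y)`, which explains the doubled arctangent. -/
theorem integral_inv_sqrt_quadratic (hy : 0 < y) :
    ∫ s in (0 : ℝ)..min 1 (1 / y), (√(1 + s / y - s ^ 2))⁻¹ = arctanKernel y := by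
  have hm0 : 0 < min 1 (1 / y) := lt_min one_pos (by positivity)
  have hpos : ∀ s ∈ Set.uIcc 0 (min 1 (1 / y)), 0 < 1 + s / y - s ^ 2 := by
    intro s hs
    rw [Set.uIcc_of_le hm0.le] at hs
    exact quadratic_pos hy hs.1 (hs.2.trans (min_le_left _ _))
  have hderiv : ∀ s ∈ Set.uIcc 0 (min 1 (1 / y)), HasDerivAt
      (fun s => Real.arctan ((s - 1 / (2 * y)) / √(1 + s / y - s ^ 2)))
      (√(1 + s / y - s ^ 2))⁻¹ s := by
    intro s hs
    have hR := hpos s hs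
    have h1 : HasDerivAt (fun s : ℝ => 1 + s / y - s ^ 2) (1 / y - 2 * s) s := by
      simpa using (((hasDerivAt_id s).div_const y).const_add 1).fun_sub (hasDerivAt_pow 2 s)
    have h2 := ((hasDerivAt_id s).sub_const (1 / (2 * y))).div (h1.sqrt hR.ne')
      (Real.sqrt_pos.2 hR).ne'
    convert! h2.arctan using 1
    obtain ⟨r, hr⟩ : ∃ r, r = √(1 + s / y - s ^ 2) := ⟨_, rfl⟩
    have hr0 : 0 < r := hr ▸ Real.sqrt_pos.2 hR
    have hr2 : r ^ 2 = 1 + s / y - s ^ 2 := hr ▸ Real.sq_sqrt hR.le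
    simp only [id, Pi.div_apply, ← hr]
    have h3 : 0 < 1 + ((s - 1 / (2 * y)) / r) ^ 2 := by positivity
    have h4 : 1 + ((s - 1 / (2 * y)) / r) ^ 2 = (r ^ 2 + (s - 1 / (2 * y)) ^ 2) / r ^ 2 := by
      field_simp
    have h5 : (1 * r - (s - 1 / (2 * y)) * ((1 / y - 2 * s) / (2 * r))) / r ^ 2 =
        (r ^ 2 + (s - 1 / (2 * y)) ^ 2) / r ^ 2 * r⁻¹ := by
      field_simp
      ring
    rw [h5, ← h4]
    field_simp
  have hcont : ContinuousOn (fun s : ℝ => (√(1 + s / y - s ^ 2))⁻¹)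
      (Set.uIcc 0 (min 1 (1 / y))) := by
    refine ContinuousOn.inv₀ (by fun_prop) fun s hs => (Real.sqrt_pos.2 (hpos s hs)).ne'
  rw [intervalIntegral.integral_eq_sub_of_hasDerivAt hderiv hcont.intervalIntegrable]
  have e0 : Real.arctan ((0 - 1 / (2 * y)) / √(1 + 0 / y - 0 ^ 2)) =
      -Real.arctan (1 / (2 * y)) := by
    rw [← Real.arctan_neg]
    congr 1
    simp
  rw [e0, sub_neg_eq_add, arctanKernel]
  split_ifs with h
  · have hm : min 1 (1 / y) = 1 := min_eq_left ((one_le_div hy).2 h)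
    have hs := Real.sqrt_pos.2 hy
    have hs2 := Real.sq_sqrt hy.le
    have e1 : √(1 + 1 / y - 1 ^ 2) = 1 / √y := by
      rw [show 1 + 1 / y - 1 ^ 2 = 1 / y by ring, Real.sqrt_div zero_le_one, Real.sqrt_one]
    rw [hm, e1, arctanNear]
    congr 2
    nth_rewrite 1 [← hs2]
    field_simp
  · have hm : min 1 (1 / y) = 1 / y := min_eq_right ((div_le_one hy).2 (not_le.1 h).le)
    have e1 : √(1 + 1 / y / y - (1 / y) ^ 2) = 1 := by
      rw [show 1 + 1 / y / y - (1 / y) ^ 2 = 1 by ring, Real.sqrt_one]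
    have e2 : (1 / y - 1 / (2 * y)) / 1 = 1 / (2 * y) := by
      field_simp
      norm_num
    rw [hm, e1, e2, arctanFar]
    ring

theorem arctanKernel_nonneg (hy : 0 < y) : 0 ≤ arctanKernel y := by
  rw [← integral_inv_sqrt_quadratic hy]
  exact intervalIntegral.integral_nonneg (lt_min one_pos (by positivity)).le
    fun s _ => by positivity

theorem lintegral_inv_sqrt_quadratic (hy : 0 < y) (δ : ℝ) :
    ∫⁻ s in Set.Ioo (0 : ℝ) (min 1 (1 / y)),
        ENNReal.ofReal (2 * y ^ (2 * δ - 1) * (√(1 + s / y - s ^ 2))⁻¹) =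
      ENNReal.ofReal (2 * y ^ (2 * δ - 1) * arctanKernel y) := by
  have hm0 : 0 < min 1 (1 / y) := lt_min one_pos (by positivity)
  have hcont : ContinuousOn (fun s : ℝ => (√(1 + s / y - s ^ 2))⁻¹)
      (Set.uIcc 0 (min 1 (1 / y))) := by
    refine ContinuousOn.inv₀ (by fun_prop) fun s hs => ?_
    rw [Set.uIcc_of_le hm0.le] at hs
    exact (Real.sqrt_pos.2 (quadratic_pos hy hs.1 (hs.2.trans (min_le_left _ _)))).ne'
  rw [← integral_inv_sqrt_quadratic hy, ← intervalIntegral.integral_const_mul,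
    intervalIntegral.integral_of_le hm0.le, integral_Ioc_eq_integral_Ioo,
    ofReal_integral_eq_lintegral_ofReal]
  · exact (intervalIntegrable_iff_integrableOn_Ioo_of_le hm0.le).1
      (hcont.intervalIntegrable.const_mul _)
  · exact ae_of_all _ fun s => by positivity

theorem hasDerivAt_arctan_inv (hy : 0 < y) :
    HasDerivAt (fun y : ℝ => Real.arctan (1 / (2 * y))) (-(2 / (4 * y ^ 2 + 1))) y := by
  have h1 : HasDerivAt (fun y : ℝ => 1 / (2 * y)) (-(1 / (2 * y ^ 2))) y := by
    have := (((hasDerivAt_id y).const_mul 2).inv (by simpa using hy.ne'))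
    simp only [id, mul_one] at this
    convert! this using 1
    · ext; simp
    · field_simp
  convert! h1.arctan using 1
  field_simp
  ring

theorem hasDerivAt_arctanFar (hy : 0 < y) :
    HasDerivAt arctanFar (-(4 / (4 * y ^ 2 + 1))) y := by
  convert! (hasDerivAt_arctan_inv hy).const_mul 2 using 1
  ring

/-- The derivative is split so that its second term is the derivative of `arctanFar`; the two ranges
of `y` then combine into one integral over `(0, ∞)`. -/
theorem hasDerivAt_arctanNear (hy : 0 < y) :
    HasDerivAt arctanNear (1 / (√y * (2 * y + 1 - 2 * √y)) - 4 / (4 * y ^ 2 + 1)) y := by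
  have hr0 := Real.sqrt_pos.2 hy
  have hr2 := Real.sq_sqrt hy.le
  have hs := (hasDerivAt_id y).sqrt hy.ne'
  simp only [id] at hs
  have h1 := (hs.sub ((hs.const_mul 2).inv (by positivity))).arctan.add (hasDerivAt_arctan_inv hy)
  convert! h1 using 1
  · ext z
    simp [arctanNear]
  · obtain ⟨r, hr⟩ : ∃ r, r = √y := ⟨_, rfl⟩
    simp only [Pi.sub_apply, Pi.inv_apply, ← hr] at *
    rw [← hr2]
    have e1 : 2 * r ^ 2 + 1 - 2 * r ≠ 0 := by nlinarith [sq_nonneg (2 * r - 1)]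
    have e2 : 1 + (r - (2 * r)⁻¹) ^ 2 = (4 * (r ^ 2) ^ 2 + 1) / (4 * r ^ 2) := by
      field_simp
      ring
    have e3 : 4 * (r ^ 2) ^ 2 + 1 ≠ 0 := by positivity
    -- Sophie Germain: `4r⁴ + 1 = (2r² + 1 - 2r)(2r² + 1 + 2r)`.
    have e4 : 1 / (r * (2 * r ^ 2 + 1 - 2 * r)) =
        (2 * r ^ 2 + 1 + 2 * r) / (r * (4 * (r ^ 2) ^ 2 + 1)) := by
      rw [div_eq_div_iff (mul_ne_zero hr0.ne' e1) (mul_ne_zero hr0.ne' e3)]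
      ring
    rw [e2, e4]
    field_simp
    ring

end ArctanKernel

/-! ### Integration by parts in `y`. -/

section IntegrationByParts

variable {δ : ℝ}

theorem hasDerivAt_inv_quadratic (y : ℝ) :
    HasDerivAt (fun y : ℝ => 1 / (1 + 4 * y ^ 2)) (-(8 * y / (1 + 4 * y ^ 2) ^ 2)) y := by
  have h1 : HasDerivAt (fun y : ℝ => 1 + 4 * y ^ 2) (8 * y) y := by
    convert! ((hasDerivAt_pow 2 y).const_mul 4).const_add 1 using 1
    norm_num
    ring
  have hne : 1 + 4 * y ^ 2 ≠ 0 := by positivity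
  convert! h1.inv hne using 1
  · ext z
    simp
  · ring

theorem injOn_inv_quadratic : Set.InjOn (fun y : ℝ => 1 / (1 + 4 * y ^ 2)) (Set.Ioi 0) := by
  intro y hy z hz h
  have h1 : (1 + 4 * y ^ 2 : ℝ) ≠ 0 := by positivity
  have h2 : (1 + 4 * z ^ 2 : ℝ) ≠ 0 := by positivity
  have h3 : y ^ 2 = z ^ 2 := by
    simp only [one_div, inv_inj] at h
    linarith
  exact (pow_left_inj₀ (le_of_lt hy) (le_of_lt hz) two_ne_zero).1 h3

theorem image_inv_quadratic :
    (fun y : ℝ => 1 / (1 + 4 * y ^ 2)) '' Set.Ioi 0 = Set.Ioo 0 1 := by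
  ext t
  constructor
  · rintro ⟨y, hy, rfl⟩
    have hy' : 0 < y := hy
    refine ⟨by positivity, ?_⟩
    rw [div_lt_one (by positivity)]
    have : 0 < y ^ 2 := by positivity
    linarith
  · intro ht
    have h1 : 0 < (1 / t - 1) / 4 := by
      have := (one_lt_div ht.1).2 ht.2
      linarith
    refine ⟨√((1 / t - 1) / 4), Real.sqrt_pos.2 h1, ?_⟩
    simp only [Real.sq_sqrt h1.le]
    rw [show 1 + 4 * ((1 / t - 1) / 4) = 1 / t by ring, one_div_one_div]

theorem beta_integrand_inv_quadratic {y : ℝ} (hy : 0 < y) (δ : ℝ) :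
    |-(8 * y / (1 + 4 * y ^ 2) ^ 2)| * ((1 / (1 + 4 * y ^ 2)) ^ ((1 / 2 - δ) - 1) *
      (1 - 1 / (1 + 4 * y ^ 2)) ^ ((1 / 2 + δ) - 1)) =
      4 ^ δ * (y ^ (2 * δ) * (4 / (4 * y ^ 2 + 1))) := by
  obtain ⟨w, hw⟩ : ∃ w, w = 1 + 4 * y ^ 2 := ⟨_, rfl⟩
  have hw0 : 0 < w := by rw [hw]; positivity
  have e1 : 1 - 1 / w = (4 * y ^ 2) / w := by
    rw [eq_div_iff hw0.ne', sub_mul, div_mul_cancel₀ _ hw0.ne', hw]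
    ring
  have e2 : (1 / w) ^ ((1 / 2 - δ) - 1) = w ^ (1 / 2 + δ) := by
    rw [one_div, Real.inv_rpow hw0.le, ← Real.rpow_neg hw0.le]
    congr 1
    ring
  have e3 : (4 * y ^ 2 / w) ^ ((1 / 2 + δ) - 1) =
      (4 ^ δ / 2 * (y ^ (2 * δ) / y)) * w ^ (1 / 2 - δ) := by
    rw [Real.div_rpow (by positivity) hw0.le, Real.mul_rpow (by norm_num) (by positivity),
      div_eq_mul_inv, ← Real.rpow_neg hw0.le, ← Real.rpow_natCast y 2, ← Real.rpow_mul hy.le]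
    congr 2
    · rw [show (1 / 2 + δ) - 1 = δ - 1 / 2 by ring, Real.rpow_sub (by norm_num),
        ← Real.sqrt_eq_rpow, show (4 : ℝ) = 2 ^ 2 by norm_num, Real.sqrt_sq (by norm_num)]
    · rw [← Real.rpow_sub_one hy.ne']
      congr 1
      push_cast
      ring
    · ring
  have e4 : w ^ (1 / 2 + δ) * w ^ (1 / 2 - δ) = w := by
    rw [← Real.rpow_add hw0]
    convert Real.rpow_one w using 2
    ring
  rw [← hw, show 4 * y ^ 2 + 1 = w by rw [hw]; ring, abs_neg, abs_of_pos (by positivity), e1, e2,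
    e3]
  calc _ = 8 * y / w ^ 2 * (4 ^ δ / 2 * (y ^ (2 * δ) / y)) *
        (w ^ (1 / 2 + δ) * w ^ (1 / 2 - δ)) := by ring
    _ = _ := by
      rw [e4]
      field_simp
      norm_num

/-- The substitution `t = 1/(1 + 4y²)` turns `B(1/2 - δ, 1/2 + δ)` into `4^δ` times this integral;
the reflection formula evaluates the beta function. -/
theorem integral_rpow_mul_inv_quadratic (h0 : -(1 / 2) < δ) (h1 : δ < 1 / 2) :
    IntegrableOn (fun y : ℝ => y ^ (2 * δ) * (4 / (4 * y ^ 2 + 1))) (Set.Ioi 0) ∧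
    ∫ y in Set.Ioi (0 : ℝ), y ^ (2 * δ) * (4 / (4 * y ^ 2 + 1)) =
      4 ^ (-δ) * Real.pi / Real.cos (Real.pi * δ) := by
  set u : ℂ := ((1 / 2 - δ : ℝ) : ℂ) with hu
  set v : ℂ := ((1 / 2 + δ : ℝ) : ℂ) with hv
  have hu0 : 0 < u.re := by rw [hu, Complex.ofReal_re]; linarith
  have hv0 : 0 < v.re := by rw [hv, Complex.ofReal_re]; linarith
  have huv : v = 1 - u := by rw [hu, hv]; push_cast; ring
  have h4 : (0 : ℝ) < 4 ^ δ := by positivity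
  set g : ℝ → ℂ := fun x => (x : ℂ) ^ (u - 1) * (1 - (x : ℂ)) ^ (v - 1) with hg
  have hgi : IntegrableOn g (Set.Ioo 0 1) :=
    (intervalIntegrable_iff_integrableOn_Ioo_of_le zero_le_one).1
      (Complex.betaIntegral_convergent hu0 hv0)
  have hgv : ∫ x in Set.Ioo 0 1, g x = Real.pi / Real.cos (Real.pi * δ) := by
    have e1 : ∫ x in Set.Ioo 0 1, g x = Complex.betaIntegral u v := by
      rw [Complex.betaIntegral, intervalIntegral.integral_of_le zero_le_one,
        integral_Ioc_eq_integral_Ioo]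
    have e2 := Complex.Gamma_mul_Gamma_eq_betaIntegral hu0 hv0
    rw [huv, Complex.Gamma_mul_Gamma_one_sub, add_sub_cancel, Complex.Gamma_one, one_mul] at e2
    rw [e1, huv, ← e2, hu]
    push_cast
    rw [show (Real.pi : ℂ) * (1 / 2 - δ) = Real.pi / 2 - Real.pi * δ by ring,
      Complex.sin_pi_div_two_sub]
  have hpt : ∀ y ∈ Set.Ioi (0 : ℝ), |-(8 * y / (1 + 4 * y ^ 2) ^ 2)| • g (1 / (1 + 4 * y ^ 2)) =
      ((4 ^ δ * (y ^ (2 * δ) * (4 / (4 * y ^ 2 + 1))) : ℝ) : ℂ) := by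
    intro y hy
    have hy' : 0 < y := hy
    have hw1 : 0 ≤ 1 - 1 / (1 + 4 * y ^ 2) := by
      rw [sub_nonneg, div_le_one (by positivity)]
      nlinarith
    rw [← beta_integrand_inv_quadratic hy' δ, hg, Complex.real_smul, hu, hv]
    push_cast [Complex.ofReal_cpow hw1,
      Complex.ofReal_cpow (show (0 : ℝ) ≤ 1 / (1 + 4 * y ^ 2) by positivity)]
    rfl
  have hd : ∀ y ∈ Set.Ioi (0 : ℝ), HasDerivWithinAt (fun y : ℝ => 1 / (1 + 4 * y ^ 2))
      (-(8 * y / (1 + 4 * y ^ 2) ^ 2)) (Set.Ioi 0) y :=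
    fun y _ => (hasDerivAt_inv_quadratic y).hasDerivWithinAt
  have hI := (integrableOn_image_iff_integrableOn_abs_deriv_smul measurableSet_Ioi hd
    injOn_inv_quadratic g).1 (by rwa [image_inv_quadratic])
  have hV := integral_image_eq_integral_abs_deriv_smul measurableSet_Ioi hd injOn_inv_quadratic g
  rw [image_inv_quadratic, hgv, setIntegral_congr_fun measurableSet_Ioi hpt] at hV
  rw [integrableOn_congr_fun hpt measurableSet_Ioi] at hI
  have hI' : IntegrableOn (fun y : ℝ => 4 ^ δ * (y ^ (2 * δ) * (4 / (4 * y ^ 2 + 1))))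
      (Set.Ioi 0) := by
    have := hI.re
    simpa only [IntegrableOn, RCLike.re_to_complex, Complex.ofReal_re] using this
  have hI2 : IntegrableOn (fun y : ℝ => y ^ (2 * δ) * (4 / (4 * y ^ 2 + 1))) (Set.Ioi 0) := by
    have := hI'.const_mul (4 ^ δ)⁻¹
    simpa only [IntegrableOn, inv_mul_cancel_left₀ h4.ne'] using this
  refine ⟨hI2, ?_⟩
  rw [integral_complex_ofReal, integral_const_mul] at hV
  have hV' : Real.pi / Real.cos (Real.pi * δ) =
      4 ^ δ * ∫ y in Set.Ioi (0 : ℝ), y ^ (2 * δ) * (4 / (4 * y ^ 2 + 1)) := by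
    exact_mod_cast hV
  rw [Real.rpow_neg (by norm_num), mul_div_assoc, hV', inv_mul_cancel_left₀ h4.ne']

theorem near_denom_pos (y : ℝ) (hy : 0 ≤ y) : 0 < 2 * y + 1 - 2 * √y := by
  have := Real.sq_sqrt hy
  nlinarith [sq_nonneg (2 * √y - 1)]

theorem integral_rpow_mul_near (h0 : 0 < δ) :
    IntervalIntegrable (fun y : ℝ => y ^ (2 * δ) * (1 / (√y * (2 * y + 1 - 2 * √y)))) volume 0 1 ∧
    ∫ y in (0 : ℝ)..1, y ^ (2 * δ) * (1 / (√y * (2 * y + 1 - 2 * √y))) =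
      ∫ x in (0 : ℝ)..1, x ^ (4 * δ) * (2 / (2 * x ^ 2 - 2 * x + 1)) := by
  constructor
  · have h : IntervalIntegrable (fun y : ℝ => y ^ (2 * δ - 1 / 2) * (1 / (2 * y + 1 - 2 * √y)))
        volume 0 1 := by
      refine (intervalIntegral.intervalIntegrable_rpow' (by linarith)).mul_continuousOn ?_
      refine ContinuousOn.div (by fun_prop) (by fun_prop) fun y hy => ?_
      rw [Set.uIcc_of_le zero_le_one] at hy
      exact (near_denom_pos y hy.1).ne'
    refine h.congr fun y hy => ?_
    rw [Set.uIoc_of_le zero_le_one] at hy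
    rw [Real.rpow_sub hy.1, ← Real.sqrt_eq_rpow]
    simp only [one_div, mul_inv]
    ring
  · rw [intervalIntegral.integral_of_le zero_le_one, intervalIntegral.integral_of_le zero_le_one,
      integral_Ioc_eq_integral_Ioo, integral_Ioc_eq_integral_Ioo, ← image_sq_Ioo,
      integral_image_eq_integral_abs_deriv_smul (f' := fun s => 2 * s) measurableSet_Ioo
      (fun s _ => by simpa using (hasDerivAt_pow 2 s).hasDerivWithinAt) injOn_sq_Ioo, image_sq_Ioo]
    refine setIntegral_congr_fun measurableSet_Ioo fun x hx => ?_
    have hx0 := hx.1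
    have hd := kernel_denom_pos x
    simp only [smul_eq_mul]
    rw [Real.sqrt_sq hx0.le, abs_of_pos (by positivity), ← Real.rpow_natCast x 2,
      ← Real.rpow_mul hx0.le, show ((2 : ℕ) : ℝ) * (2 * δ) = 4 * δ by push_cast; ring,
      Real.rpow_natCast, show 2 * x ^ 2 + 1 - 2 * x = 2 * x ^ 2 - 2 * x + 1 by ring]
    field_simp

theorem arctan_le_self {x : ℝ} (hx : 0 ≤ x) : Real.arctan x ≤ x := by
  have := Real.le_tan (Real.arctan_nonneg.2 hx) (Real.arctan_lt_pi_div_two x)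
  rwa [Real.tan_arctan] at this

/-- Boundary term at infinity: `arctanFar y ≤ 1/y`, which beats `y^(2δ)` as `2δ < 1`. -/
theorem tendsto_rpow_mul_arctanFar (h1 : δ < 1 / 2) :
    Tendsto (fun y : ℝ => y ^ (2 * δ) * arctanFar y) atTop (𝓝 0) := by
  have hlim : Tendsto (fun y : ℝ => y ^ (-(1 - 2 * δ))) atTop (𝓝 0) :=
    tendsto_rpow_neg_atTop (by linarith)
  refine squeeze_zero' ?_ ?_ hlim
  · filter_upwards [eventually_gt_atTop 0] with y hy
    have : 0 ≤ Real.arctan (1 / (2 * y)) := Real.arctan_nonneg.2 (by positivity)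
    rw [arctanFar]
    positivity
  · filter_upwards [eventually_gt_atTop 0] with y hy
    have h2 : Real.arctan (1 / (2 * y)) ≤ 1 / (2 * y) := arctan_le_self (by positivity)
    have h3 : arctanFar y ≤ y⁻¹ := by
      rw [arctanFar]
      calc 2 * Real.arctan (1 / (2 * y)) ≤ 2 * (1 / (2 * y)) := by gcongr
        _ = y⁻¹ := by field_simp
    calc y ^ (2 * δ) * arctanFar y ≤ y ^ (2 * δ) * y⁻¹ := by gcongr
      _ = y ^ (-(1 - 2 * δ)) := by
        rw [← Real.rpow_neg_one y, ← Real.rpow_add hy]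
        congr 1
        ring

theorem tendsto_rpow_mul_arctanNear (h0 : 0 < δ) :
    Tendsto (fun y : ℝ => y ^ (2 * δ) * arctanNear y) (𝓝[>] 0) (𝓝 0) := by
  have hlim : Tendsto (fun y : ℝ => y ^ (2 * δ)) (𝓝[>] 0) (𝓝 0) := by
    have := (Real.continuousAt_rpow_const 0 (2 * δ) (Or.inr (by linarith))).tendsto
    rw [Real.zero_rpow (by linarith)] at this
    exact this.mono_left nhdsWithin_le_nhds
  refine hlim.zero_mul_isBoundedUnder_le (isBoundedUnder_of ⟨Real.pi, fun y => ?_⟩)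
  simp only [Function.comp, arctanNear, Real.norm_eq_abs, abs_le]
  have h1 := Real.arctan_lt_pi_div_two (√y - 1 / (2 * √y))
  have h2 := Real.neg_pi_div_two_lt_arctan (√y - 1 / (2 * √y))
  have h3 := Real.arctan_lt_pi_div_two (1 / (2 * y))
  have h4 := Real.neg_pi_div_two_lt_arctan (1 / (2 * y))
  constructor <;> linarith

/-- The weight `δ · 2y^(2δ-1)` is the derivative of `y^(2δ)`. Parts are taken on `(0,1]` and `(1,∞)`
separately; the outer boundary terms vanish and those at `y = 1` cancel, the kernel being continuous
there. -/
theorem integral_arctanKernel (h0 : 0 < δ) (h1 : δ < 1 / 2)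
    (hint : IntegrableOn (fun y : ℝ => 2 * y ^ (2 * δ - 1) * arctanKernel y) (Set.Ioi 0)) :
    -δ * ∫ y in Set.Ioi (0 : ℝ), 2 * y ^ (2 * δ - 1) * arctanKernel y =
      (∫ x in (0 : ℝ)..1, x ^ (4 * δ) * (2 / (2 * x ^ 2 - 2 * x + 1))) -
        4 ^ (-δ) * Real.pi / Real.cos (Real.pi * δ) := by
  obtain ⟨hQi, hQv⟩ := integral_rpow_mul_inv_quadratic (δ := δ) (by linarith) h1
  obtain ⟨hNi, hNv⟩ := integral_rpow_mul_near h0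
  have hU : Set.Ioi (0 : ℝ) = Set.Ioc 0 1 ∪ Set.Ioi 1 := (Set.Ioc_union_Ioi_eq_Ioi zero_le_one).symm
  have hdisj : Disjoint (Set.Ioc (0 : ℝ) 1) (Set.Ioi 1) := Set.Ioc_disjoint_Ioi le_rfl
  rw [hU, integrableOn_union] at hint hQi
  have hKnear : ∀ y ∈ Set.Ioc (0 : ℝ) 1, 2 * y ^ (2 * δ - 1) * arctanKernel y =
      2 * y ^ (2 * δ - 1) * arctanNear y := fun y hy => by rw [arctanKernel, if_pos hy.2]
  have hKfar : ∀ y ∈ Set.Ioi (1 : ℝ), 2 * y ^ (2 * δ - 1) * arctanKernel y =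
      2 * y ^ (2 * δ - 1) * arctanFar y := fun y hy => by rw [arctanKernel, if_neg (not_le.2 hy)]
  have hi1 := hint.1
  have hi2 := hint.2
  rw [integrableOn_congr_fun hKnear measurableSet_Ioc] at hi1
  rw [integrableOn_congr_fun hKfar measurableSet_Ioi] at hi2
  have hi1' := (intervalIntegrable_iff_integrableOn_Ioc_of_le zero_le_one).2 hi1
  have hQ1' := (intervalIntegrable_iff_integrableOn_Ioc_of_le zero_le_one).2 hQi.1
  have hrpow : ∀ y : ℝ, 0 < y → HasDerivAt (fun y : ℝ => y ^ (2 * δ))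
      (2 * δ * y ^ (2 * δ - 1)) y := fun y hy => Real.hasDerivAt_rpow_const (Or.inl hy.ne')
  have hnear : ∫ y in (0 : ℝ)..1, (δ * (2 * y ^ (2 * δ - 1) * arctanNear y) +
      (y ^ (2 * δ) * (1 / (√y * (2 * y + 1 - 2 * √y))) -
        y ^ (2 * δ) * (4 / (4 * y ^ 2 + 1)))) = arctanNear 1 - 0 := by
    refine intervalIntegral.integral_eq_sub_of_hasDerivAt_of_tendsto
      (f := fun y => y ^ (2 * δ) * arctanNear y) zero_lt_one (fun y hy => ?_)
      ((hi1'.const_mul δ).add (hNi.sub hQ1')) (tendsto_rpow_mul_arctanNear h0) ?_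
    · convert! (hrpow y hy.1).mul (hasDerivAt_arctanNear hy.1) using 1
      ring
    · have := ((hrpow 1 one_pos).mul (hasDerivAt_arctanNear one_pos)).continuousAt.tendsto
      simp only [Pi.mul_apply, Real.one_rpow, one_mul] at this
      exact this.mono_left nhdsWithin_le_nhds
  have hfar : ∫ y in Set.Ioi (1 : ℝ), (δ * (2 * y ^ (2 * δ - 1) * arctanFar y) -
      y ^ (2 * δ) * (4 / (4 * y ^ 2 + 1))) = 0 - 1 ^ (2 * δ) * arctanFar 1 := by
    refine integral_Ioi_of_hasDerivAt_of_tendsto' (f := fun y => y ^ (2 * δ) * arctanFar y)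
      (fun y hy => ?_) ((hi2.const_mul δ).sub hQi.2) (tendsto_rpow_mul_arctanFar h1)
    have hy0 : 0 < y := lt_of_lt_of_le one_pos hy
    convert! (hrpow y hy0).mul (hasDerivAt_arctanFar hy0) using 1
    ring
  rw [intervalIntegral.integral_add (hi1'.const_mul δ) (hNi.sub hQ1'),
    intervalIntegral.integral_sub hNi hQ1', intervalIntegral.integral_const_mul, hNv,
    intervalIntegral.integral_of_le zero_le_one, intervalIntegral.integral_of_le zero_le_one,
    intervalIntegral.integral_of_le zero_le_one] at hnear
  rw [integral_sub (hi2.const_mul δ) hQi.2, integral_const_mul] at hfar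
  rw [hU, setIntegral_union hdisj measurableSet_Ioi hQi.1 hQi.2] at hQv
  rw [hU, setIntegral_union hdisj measurableSet_Ioi hint.1 hint.2,
    setIntegral_congr_fun measurableSet_Ioc hKnear, setIntegral_congr_fun measurableSet_Ioi hKfar,
    ← hQv]
  have h2 : arctanNear 1 = arctanFar 1 := by
    rw [arctanNear, arctanFar, Real.sqrt_one]
    norm_num
    ring
  rw [h2] at hnear
  rw [Real.one_rpow] at hfar
  rw [intervalIntegral.integral_of_le zero_le_one]
  linear_combination -hnear - hfar

end IntegrationByParts

/-! ### The identity for `α = -δ`, `0 < δ < 1/2`. -/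

section RealCase

variable {δ : ℝ}

theorem ofReal_hypTerm_eq (u v : ℝ) (k : ℕ) :
    ((k.factorial * (ascPochhammer ℝ k).eval (1 / 2) / ((ascPochhammer ℝ (k + 1)).eval u *
      (ascPochhammer ℝ (k + 1)).eval v) : ℝ) : ℂ) = hypTerm (u + 1) (v + 1) k / (u * v) := by
  have h1 := mul_ascPochhammer_eval_add_one (u : ℂ) k
  have h2 := mul_ascPochhammer_eval_add_one (v : ℂ) k
  rw [← ascPochhammer_succ_eval] at h1 h2
  push_cast
  simp only [ofReal_ascPochhammer_eval]
  rw [← h1, ← h2, hypTerm, div_div]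
  push_cast
  congr 1
  ring

theorem summable_hypTerm_real (h0 : 0 < δ) (h1 : δ < 1 / 2) :
    Summable (hypTerm ((1 / 2 - δ : ℝ) + 1) ((1 / 2 + 2 * δ : ℝ) + 1)) := by
  refine summable_hypTerm (ne_neg_natCast_of_re_pos ?_) (ne_neg_natCast_of_re_pos ?_) ?_
  · simp only [Complex.add_re, Complex.ofReal_re, Complex.one_re]
    linarith
  · simp only [Complex.add_re, Complex.ofReal_re, Complex.one_re]
    linarith
  · simp only [Complex.add_re, Complex.sub_re, Complex.ofReal_re, Complex.one_re]
    norm_num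
    linarith

/-- The evaluation of the series for real `α = -δ`, `0 < δ < 1/2`. -/
theorem tsum_real_eq (h0 : 0 < δ) (h1 : δ < 1 / 2) :
    -δ * ∑' k : ℕ, (k.factorial * (ascPochhammer ℝ k).eval (1 / 2) /
        ((ascPochhammer ℝ (k + 1)).eval (1 / 2 - δ) *
          (ascPochhammer ℝ (k + 1)).eval (1 / 2 + 2 * δ))) =
      (∫ x in (0 : ℝ)..1, x ^ (4 * δ) * (2 / (2 * x ^ 2 - 2 * x + 1))) -
        4 ^ (-δ) * Real.pi / Real.cos (Real.pi * δ) := by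
  have hu : 0 < 1 / 2 - δ := by linarith
  have hv : 0 < 1 / 2 + 2 * δ := by linarith
  have hnn : ∀ k : ℕ, 0 ≤ k.factorial * (ascPochhammer ℝ k).eval (1 / 2) /
      ((ascPochhammer ℝ (k + 1)).eval (1 / 2 - δ) *
        (ascPochhammer ℝ (k + 1)).eval (1 / 2 + 2 * δ)) := fun k => by
    have := ascPochhammer_eval_pos hu (k + 1)
    have := ascPochhammer_eval_pos hv (k + 1)
    have := ascPochhammer_eval_pos (u := 1 / 2) (by norm_num) k
    positivity
  have hsum : Summable fun k : ℕ => k.factorial * (ascPochhammer ℝ k).eval (1 / 2) /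
      ((ascPochhammer ℝ (k + 1)).eval (1 / 2 - δ) *
        (ascPochhammer ℝ (k + 1)).eval (1 / 2 + 2 * δ)) := by
    rw [← Complex.summable_ofReal]
    simp only [ofReal_hypTerm_eq]
    exact (summable_hypTerm_real h0 h1).div_const _
  have hE := tsum_eq_lintegral_lintegral hu hv
  rw [lintegral_lintegral_substitution, lintegral_lintegral_swap_hyperbola (by fun_prop),
    setLIntegral_congr_fun measurableSet_Ioi
      (fun y hy => lintegral_inv_sqrt_quadratic (Set.mem_Ioi.1 hy) δ),
    ← ENNReal.ofReal_tsum_of_nonneg hnn hsum] at hE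
  have hmeas : AEStronglyMeasurable (fun y : ℝ => 2 * y ^ (2 * δ - 1) * arctanKernel y)
      (volume.restrict (Set.Ioi 0)) := by
    have := measurable_arctanKernel
    exact Measurable.aestronglyMeasurable (by fun_prop)
  have hnn' : 0 ≤ᵐ[volume.restrict (Set.Ioi 0)]
      fun y : ℝ => 2 * y ^ (2 * δ - 1) * arctanKernel y := by
    refine (ae_restrict_iff' measurableSet_Ioi).2 (ae_of_all _ fun y hy => ?_)
    have hy' : 0 < y := hy
    have := arctanKernel_nonneg hy'
    positivity
  -- Integrability comes from the series: the `ENNReal` integral equals its finite sum.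
  have hint : IntegrableOn (fun y : ℝ => 2 * y ^ (2 * δ - 1) * arctanKernel y) (Set.Ioi 0) := by
    rw [IntegrableOn, ← lintegral_ofReal_ne_top_iff_integrable hmeas hnn', ← hE]
    exact ENNReal.ofReal_ne_top
  have hval : ∫ y in Set.Ioi (0 : ℝ), 2 * y ^ (2 * δ - 1) * arctanKernel y =
      ∑' k : ℕ, (k.factorial * (ascPochhammer ℝ k).eval (1 / 2) /
        ((ascPochhammer ℝ (k + 1)).eval (1 / 2 - δ) *
          (ascPochhammer ℝ (k + 1)).eval (1 / 2 + 2 * δ))) := by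
    rw [integral_eq_lintegral_of_nonneg_ae hnn' hmeas, ← hE,
      ENNReal.toReal_ofReal (tsum_nonneg hnn)]
  rw [← hval]
  exact integral_arctanKernel h0 h1 hint

end RealCase

/-! ### Analytic continuation in `α`. -/

section Continuation

/-- The exponents `α` at which both sides of the main identity are regular. -/
def mainDomain : Set ℂ := {α | (∀ n : ℤ, 2 * α ≠ n) ∧ ∀ n : ℕ, 4 * α ≠ 2 * n + 1}

theorem isPreconnected_mainDomain : IsPreconnected mainDomain := by
  have hE : mainDomain = (Set.range (fun n : ℤ => (n : ℂ) / 2) ∪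
      Set.range (fun n : ℕ => (2 * (n : ℂ) + 1) / 4))ᶜ := by
    ext α
    constructor
    · rintro ⟨h1, h2⟩ (⟨n, rfl⟩ | ⟨n, rfl⟩)
      · exact h1 n (by ring)
      · exact h2 n (by ring)
    · intro h
      refine ⟨fun n hn => h (Or.inl ⟨n, ?_⟩), fun n hn => h (Or.inr ⟨n, ?_⟩)⟩
      · simp only [← hn]; ring
      · simp only [← hn]; ring
  rw [hE]
  refine (Set.Countable.isConnected_compl_of_one_lt_rank ?_ ?_).isPreconnected
  · rw [Complex.rank_real_complex]; norm_num
  · exact (Set.countable_range _).union (Set.countable_range _)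

/-- The hypergeometric side of the main identity. -/
noncomputable def hypSide (α : ℂ) : ℂ :=
  α / ((α + 1 / 2) * (-2 * α + 1 / 2)) * hypCont (α + 3 / 2) (-2 * α + 3 / 2)

/-- The integral side of the main identity. -/
noncomputable def integralSide (ε : ℝ) (α : ℂ) : ℂ :=
  kernelIntegral ε (-4 * α) - 4 ^ α * Real.pi / Complex.cos (Real.pi * α)

variable {α : ℂ} {ε : ℝ}

theorem lower_left_ne (h : ∀ n : ℤ, 2 * α ≠ n) (n : ℕ) : α + 3 / 2 ≠ -(n : ℂ) := fun h' =>
  h (-2 * n - 3) (by push_cast; linear_combination 2 * h')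

theorem lower_right_ne (h : ∀ n : ℕ, 4 * α ≠ 2 * n + 1) (n : ℕ) : -2 * α + 3 / 2 ≠ -(n : ℂ) :=
  fun h' => h (n + 1) (by push_cast; linear_combination -2 * h')

theorem excess_ne (h : ∀ n : ℤ, 2 * α ≠ n) (n : ℕ) :
    α + 3 / 2 + (-2 * α + 3 / 2) - 5 / 2 ≠ -(n : ℂ) := fun h' =>
  h (2 * n + 1) (by push_cast; linear_combination -2 * h')

/-- The poles are at `4α = n + 1`: odd `n` would make `2α` an integer, even `n` is the second
exclusion. -/
theorem exponent_ne (h : α ∈ mainDomain) (n : ℕ) : -4 * α + n + 1 ≠ 0 := by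
  intro h'
  rcases Nat.even_or_odd n with ⟨m, rfl⟩ | ⟨m, rfl⟩
  · exact h.2 m (by push_cast at h'; linear_combination -h')
  · exact h.1 (m + 1) (by push_cast at h' ⊢; linear_combination -h' / 2)

theorem analyticOnNhd_hypSide : AnalyticOnNhd ℂ hypSide mainDomain := by
  intro α h
  have h1 := analyticAt_hypCont_comp (d := fun z => z + 3 / 2) (c := fun z => -2 * z + 3 / 2)
    (by fun_prop) (by fun_prop) (lower_left_ne h.1) (lower_right_ne h.2) (excess_ne h.1)
  refine AnalyticAt.mul (AnalyticAt.div (by fun_prop) (by fun_prop) (mul_ne_zero ?_ ?_)) h1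
  · intro h'
    exact h.1 (-1) (by push_cast; linear_combination 2 * h')
  · intro h'
    exact h.2 0 (by push_cast; linear_combination -2 * h')

theorem analyticOnNhd_integralSide (hε : 0 < ε) (hε' : ε < 1 / √2) :
    AnalyticOnNhd ℂ (integralSide ε) mainDomain := by
  intro α h
  have h1 : AnalyticAt ℂ (fun z => kernelIntegral ε (-4 * z)) α :=
    (analyticAt_kernelIntegral hε hε' (exponent_ne h)).fun_comp (f := fun z => -4 * z) (by fun_prop)
  have h2 : AnalyticAt ℂ (fun z : ℂ => (4 : ℂ) ^ z) α := by
    refine Differentiable.analyticAt (fun z => ?_) _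
    exact ((hasDerivAt_id z).const_cpow (Or.inl (by norm_num))).differentiableAt
  refine h1.sub (AnalyticAt.div (h2.mul analyticAt_const) ?_ ?_)
  · exact Differentiable.analyticAt (by fun_prop) _
  · intro h'
    obtain ⟨k, hk⟩ := Complex.cos_eq_zero_iff.1 h'
    have hpi : (Real.pi : ℂ) ≠ 0 := by exact_mod_cast Real.pi_ne_zero
    refine h.1 (2 * k + 1) (mul_left_cancel₀ hpi ?_)
    push_cast
    linear_combination 2 * hk

/-- At `α = -δ` the parametric excess is `1/2 + δ > 0` and the exponent is `4δ > 0`, so both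
continuations reduce to convergent expressions. -/
theorem hypSide_neg_ofReal (hε : 0 < ε) (hε' : ε < 1 / √2) {δ : ℝ} (h0 : 0 < δ) (h1 : δ < 1 / 2) :
    hypSide (-δ) = integralSide ε (-δ) := by
  have hT := congrArg ((↑) : ℝ → ℂ) (tsum_real_eq h0 h1)
  have hcos : Complex.cos (Real.pi * (-δ)) = ((Real.cos (Real.pi * δ) : ℝ) : ℂ) := by
    push_cast
    rw [mul_neg, Complex.cos_neg]
  have hpow : (4 : ℂ) ^ (-δ : ℂ) = ((4 ^ (-δ) : ℝ) : ℂ) := by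
    rw [Complex.ofReal_cpow (by norm_num)]
    push_cast
    rfl
  have hI : kernelIntegral ε (-4 * (-δ)) =
      ((∫ x in (0 : ℝ)..1, x ^ (4 * δ) * (2 / (2 * x ^ 2 - 2 * x + 1)) : ℝ) : ℂ) := by
    rw [← integral_zero_one_kernel hε hε' (by simpa using h0.le),
      ← intervalIntegral.integral_ofReal]
    refine intervalIntegral.integral_congr fun x hx => ?_
    rw [Set.uIcc_of_le zero_le_one] at hx
    push_cast [Complex.ofReal_cpow hx.1]
    congr 2
    ring
  have hS : hypCont (-δ + 3 / 2) (-2 * (-δ) + 3 / 2) =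
      ∑' k, hypTerm ((1 / 2 - δ : ℝ) + 1) ((1 / 2 + 2 * δ : ℝ) + 1) k := by
    rw [hypCont_eq_hypSum (ne_neg_natCast_of_re_pos ?_) (ne_neg_natCast_of_re_pos ?_), hypSum,
      show -(δ : ℂ) + 3 / 2 = (1 / 2 - δ : ℝ) + 1 by push_cast; ring,
      show -2 * -(δ : ℂ) + 3 / 2 = (1 / 2 + 2 * δ : ℝ) + 1 by push_cast; ring]
    · norm_num
      linarith
    · norm_num
      linarith
    · norm_num
      linarith
  rw [hypSide, integralSide, hS, hcos, hpow, hI]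
  push_cast at hT ⊢
  rw [← hT]
  have hterm : ∀ k : ℕ, (k.factorial : ℂ) * (((ascPochhammer ℝ k).eval (1 / 2) : ℝ) : ℂ) /
      ((((ascPochhammer ℝ (k + 1)).eval (1 / 2 - δ) : ℝ) : ℂ) *
        (((ascPochhammer ℝ (k + 1)).eval (1 / 2 + 2 * δ) : ℝ) : ℂ)) =
      hypTerm ((1 / 2 - δ : ℝ) + 1) ((1 / 2 + 2 * δ : ℝ) + 1) k /
        ((1 / 2 - δ : ℝ) * (1 / 2 + 2 * δ : ℝ)) := by
    intro k
    rw [← ofReal_hypTerm_eq]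
    push_cast
    rfl
  simp only [hterm, tsum_div_const]
  push_cast
  rw [show (-(δ : ℂ) + 1 / 2) * (-2 * -(δ : ℂ) + 1 / 2) = (1 / 2 - δ) * (1 / 2 + 2 * δ) by ring]
  ring

theorem hypSide_eq_integralSide (hε : 0 < ε) (hε' : ε < 1 / √2) (hα : α ∈ mainDomain) :
    hypSide α = integralSide ε α := by
  -- Any point of the segment `(-1/2, 0)` would do as the accumulation point for the identity
  -- theorem.
  have hmem : ((-(1 / 8) : ℝ) : ℂ) ∈ mainDomain := by
    constructor
    · intro n hn
      have h : ((-1 : ℤ) : ℂ) = ((4 * n : ℤ) : ℂ) := by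
        push_cast at hn ⊢
        linear_combination 4 * hn
      have := Int.cast_injective h
      omega
    · intro n hn
      have h : ((-1 : ℤ) : ℂ) = ((4 * n + 2 : ℤ) : ℂ) := by
        push_cast at hn ⊢
        linear_combination 2 * hn
      have := Int.cast_injective h
      omega
  refine analyticOnNhd_hypSide.eqOn_of_preconnected_of_frequently_eq
    (analyticOnNhd_integralSide hε hε') isPreconnected_mainDomain hmem ?_ hα
  have hev : ∀ᶠ t : ℝ in 𝓝[≠] (-(1 / 8)), hypSide t = integralSide ε t := by
    refine eventually_nhdsWithin_of_eventually_nhds ?_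
    filter_upwards [Ioo_mem_nhds (show (-(1 / 2) : ℝ) < -(1 / 8) by norm_num)
      (show (-(1 / 8) : ℝ) < 0 by norm_num)] with t ht
    have := hypSide_neg_ofReal hε hε' (δ := -t) (by linarith [ht.2]) (by linarith [ht.1])
    simpa using this
  have ht : Tendsto ((↑) : ℝ → ℂ) (𝓝[≠] (-(1 / 8))) (𝓝[≠] ((-(1 / 8) : ℝ) : ℂ)) :=
    tendsto_nhdsWithin_of_tendsto_nhds_of_eventually_within _
      (Complex.continuous_ofReal.continuousAt.tendsto.mono_left nhdsWithin_le_nhds)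
      (eventually_nhdsWithin_of_forall fun t ht h => ht (Complex.ofReal_injective h))
  exact ht.frequently hev.frequently

theorem exists_isHyp3F2AtOne_eq (hε : 0 < ε) (hε' : ε < 1 / √2) (hα : α ∈ mainDomain) :
    ∃ F : ℂ, IsHyp3F2AtOne 1 1 (1 / 2) (α + 3 / 2) (-2 * α + 3 / 2) F ∧
      α / ((α + 1 / 2) * (-2 * α + 1 / 2)) * F =
        pochhammerIntegral ε (-4 * α) (fun x => 2 / (2 * x ^ 2 - 2 * x + 1)) -
          4 ^ α * Real.pi / Complex.cos (Real.pi * α) := by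
  refine ⟨_, isHyp3F2AtOne_hypCont (lower_left_ne hα.1) (lower_right_ne hα.2) (excess_ne hα.1), ?_⟩
  rw [pochhammerIntegral_kernel hε hε' (exponent_ne hα)]
  exact hypSide_eq_integralSide hε hε' hα

end Continuation

theorem mainTheorem2 (α : ℂ) (hα : ∀ n : ℤ, 2 * α ≠ n)
    (ε : ℝ) (hε : 0 < ε) (hε' : ε < 1 / Real.sqrt 2) :
    ((∀ n : ℕ, 4 * α ≠ 2 * n + 1) →
      ∃ F : ℂ, IsHyp3F2AtOne 1 1 (1 / 2) (α + 3 / 2) (-2 * α + 3 / 2) F ∧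
        α / ((α + 1 / 2) * (-2 * α + 1 / 2)) * F =
          pochhammerIntegral ε (-4 * α) (fun x => 2 / (2 * x ^ 2 - 2 * x + 1)) -
            4 ^ α * Real.pi / Complex.cos (Real.pi * α)) ∧
    ((∀ n : ℕ, 4 * α ≠ 2 * n + 3) →
      ∃ F : ℂ, IsHyp3F2AtOne 1 1 (1 / 2) (α + 1) (-2 * α + 5 / 2) F ∧
        (α - 1 / 2) / ((-2 * α + 3 / 2) * α) * F =
          pochhammerIntegral ε (-4 * α + 2) (fun x => 2 / (2 * x ^ 2 - 2 * x + 1)) -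
            2 ^ (2 * α - 1) * Real.pi / Complex.cos (Real.pi * α - Real.pi / 2)) := by
  refine ⟨fun h => exists_isHyp3F2AtOne_eq hε hε' ⟨hα, h⟩, fun h => ?_⟩
  -- The second identity is the first at `α - 1/2`, up to rewriting parameters and the power of 2.
  have hmem : α - 1 / 2 ∈ mainDomain :=
    ⟨fun n hn => hα (n + 1) (by push_cast; linear_combination hn),
      fun n hn => h n (by linear_combination hn)⟩
  obtain ⟨F, hF, hEq⟩ := exists_isHyp3F2AtOne_eq hε hε' hmem
  have hpow : (2 : ℂ) ^ (2 * α - 1) = 4 ^ (α - 1 / 2) := by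
    have harg : Complex.arg 2 = 0 := by simp
    rw [show 2 * α - 1 = 2 * (α - 1 / 2) by ring, Complex.cpow_ofNat_mul']
    · norm_num
    · rw [harg, mul_zero]
      exact neg_lt_zero.2 Real.pi_pos
    · rw [harg, mul_zero]
      exact Real.pi_pos.le
  refine ⟨F, ?_, ?_⟩
  · convert hF using 1 <;> ring
  · rw [hpow, show (α - 1 / 2) / ((-2 * α + 3 / 2) * α) =
      (α - 1 / 2) / ((α - 1 / 2 + 1 / 2) * (-2 * (α - 1 / 2) + 1 / 2)) by congr 1; ring, hEq,
      show -4 * (α - 1 / 2) = -4 * α + 2 by ring,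
      show (Real.pi : ℂ) * (α - 1 / 2) = Real.pi * α - Real.pi / 2 by ring]
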